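/- All structures are finite relational structures with finitely many relations of positive arity. In a multi-sorted structure each relation is a subset of a product $H_{i_1}\times\dots\times H_{i_r}$ of the domains; a single-sorted structure is one with a single domain. For a (multi-sorted) structure $\mathcal H$ and a prime $p$, $\#_p\mathrm{CSP}(\mathcal H)$ is the problem of computing, given a finite structure $\mathcal G$ similar to $\mathcal H$ (equivalently, a finite set of variables with sorts and a finite list of constraints over the relations of $\mathcal H$), the number of homomorphisms from $\mathcal G$ to $\mathcal H$ (equivalently, of solutions) modulo $p$. A problem $A$ is polynomial time reducible to $B$ if there is a polynomial time algorithm that solves $A$ using $B$ as an oracle. A $2$-automorphic polynomial of a single-sorted structure $\mathcal H$ with universe $H$ is a binary polymorphism $f$ of $\mathcal H$ such that for every $c\in H$ the map $x\mapsto f(c,x)$ is the identity or a permutation of $H$ of order $2$, the latter for at least one $c$. A set $A\subseteq H$ is a $2$-subalgebra of $\mathcal H$ if there is a conjunction $\Phi(x,y_1,\dots,y_m)$ of equalities and atomic formulas over $\mathcal H$ such that $c\in A$ if and only if the number of $(b_1,\dots,b_m)\in H^m$ for which $\Phi(c,b_1,\dots,b_m)$ is true is odd. The spectrum of a structure is the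 sequence $(n_1,n_2,\dots)$, where $n_j$ is the number of its domains with exactly $j$ elements; spectra are compared by the lexicographic order $\prec$ in which later entries are more senior. **Corollary 3.3.** Let $\mathcal H$ be a single-sorted structure whose universe $H$ has exactly $3$ elements and which contains all constant relations $\{c\}$, $c\in H$, among its relations. Let $f$ be a $2$-automorphic polynomial of $\mathcal H$, and let $a\in H$ be such that $x\mapsto f(a,x)$ is a permutation of order $2$. Suppose that $\{a\}$ and $H-\{a\}$ are $2$-subalgebras of $\mathcal H$. Let $\mathcal H^f$ be the two-sorted structure with the domains $H'=H-\{a\}$ and $H''=H-B$, where $B$ is the union of the nontrivial orbits of $x\mapsto f(a,x)$, whose relations are all the restrictions $R\cap(D_1\times\dots\times D_r)$ of relations $R$ of $\mathcal H$, of any arity $r$, with $D_1,\dots,D_r\in\{H',H''\}$. Then $\mathsf{Sp}(\mathcal H^f)\prec\mathsf{Sp}(\mathcal H)$, and $\#_2\mathrm{CSP}(\mathcal H)$ and $\#_2\mathrm{CSP}(\mathcal H^f)$ are polynomial time reducible to each other. -/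

import Mathlib

/-! ## Relational structures -/

/-- A finite single-sorted relational structure `(H; R_1, …, R_ℓ)`: a finite universe, finitely
many relation symbols of positive arity, and an interpretation of each of them. -/
structure RelStructure where
  /-- the universe -/
  carrier : Type
  [fintypeCarrier : Fintype carrier]
  /-- the relation symbols -/
  Symb : Type
  [fintypeSymb : Fintype Symb]
  /-- the arity of a symbol -/
  arity : Symb → ℕ
  arity_pos : ∀ R, 0 < arity R
  /-- the interpretation of a symbol -/
  rel : (R : Symb) → Set (Fin (arity R) → carrier)

/-- A finite multi-sorted relational structure: a finite collection of finite domains, one for each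
sort, finitely many relation symbols of positive arity, each with a type (a sequence of sorts), and
an interpretation of each of them as a relation between the corresponding domains. -/
structure MultiStructure where
  /-- the sorts -/
  Srt : Type
  [fintypeSrt : Fintype Srt]
  /-- the domain of a sort -/
  Dom : Srt → Type
  [fintypeDom : ∀ i, Fintype (Dom i)]
  /-- the relation symbols -/
  Symb : Type
  [fintypeSymb : Fintype Symb]
  /-- the arity of a symbol -/
  arity : Symb → ℕ
  arity_pos : ∀ R, 0 < arity R
  /-- the type of a symbol: the sort of each of its coordinates -/
  type : (R : Symb) → Fin (arity R) → Srt
  /-- the interpretation of a symbol -/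
  rel : (R : Symb) → Set ((s : Fin (arity R)) → Dom (type R s))

attribute [instance] RelStructure.fintypeCarrier RelStructure.fintypeSymb
  MultiStructure.fintypeSrt MultiStructure.fintypeDom MultiStructure.fintypeSymb

/-- A single-sorted structure is a multi-sorted structure with exactly one sort. -/
def RelStructure.toMulti (H : RelStructure) : MultiStructure where
  Srt := Unit
  Dom _ := H.carrier
  Symb := H.Symb
  arity := H.arity
  arity_pos := H.arity_pos
  type _ _ := ()
  rel := H.rel

/-- The spectrum of a multi-sorted structure: `spectrum H j` is the number of domains with exactly
`j` elements (only the values at `j ≥ 1` are used below). -/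
noncomputable def MultiStructure.spectrum (H : MultiStructure) (j : ℕ) : ℕ :=
  Nat.card {i : H.Srt // Nat.card (H.Dom i) = j}

/-- The strict lexicographic order on sequences `(n_1, n_2, …)` in which later entries are more
senior. -/
def SpectrumLT (m n : ℕ → ℕ) : Prop :=
  ∃ j, 1 ≤ j ∧ m j < n j ∧ ∀ i, j < i → m i = n i

namespace RelStructure

/-- `H` contains every constant relation `C_x = {x}` among its relations. -/
def HasConstants (H : RelStructure) : Prop :=
  ∀ x : H.carrier, ∃ R : H.Symb, H.arity R = 1 ∧ H.rel R = {t | ∀ s, t s = x}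

/-! ### Binary polymorphisms and automorphic polynomials -/

/-- `f` is a binary polymorphism of `H`: applied coordinatewise, it maps any two tuples of a
relation of `H` to a tuple of the same relation. -/
def IsBinaryPolymorphism (H : RelStructure) (f : H.carrier → H.carrier → H.carrier) : Prop :=
  ∀ R : H.Symb, ∀ u ∈ H.rel R, ∀ v ∈ H.rel R, (fun s => f (u s) (v s)) ∈ H.rel R

end RelStructure

/-- The map `g` is a permutation of order `p`. -/
def IsPermOfOrder {α : Type} (p : ℕ) (g : α → α) : Prop :=
  ∃ σ : Equiv.Perm α, (∀ x, σ x = g x) ∧ orderOf σ = p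

namespace RelStructure

/-- `f` is a `p`-automorphic polynomial of `H`: a binary polymorphism such that every map
`x ↦ f a x` is the identity or a permutation of order `p`, the latter for at least one `a`. -/
def IsAutomorphicPolynomial (H : RelStructure) (p : ℕ)
    (f : H.carrier → H.carrier → H.carrier) : Prop :=
  H.IsBinaryPolymorphism f ∧
    (∀ a, (∀ x, f a x = x) ∨ IsPermOfOrder p (f a)) ∧ ∃ a, IsPermOfOrder p (f a)

/-! ### Modular primitive positive definitions -/

/-- An atomic formula over the structure `H` with variables from `X`. -/
inductive Atom (H : RelStructure) (X : Type) : Type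
  | eq (y z : X) : Atom H X
  | rel (R : H.Symb) (z : Fin (H.arity R) → X) : Atom H X

/-- Truth of an atomic formula under an assignment of its variables. -/
def Atom.Holds {H : RelStructure} {X : Type} (v : X → H.carrier) : Atom H X → Prop
  | .eq y z => v y = v z
  | .rel R z => (fun s => v (z s)) ∈ H.rel R

/-- The number of assignments `y` of the `m` quantified variables that make the conjunction `Φ`
true together with the assignment `x` of the free variables. -/
noncomputable def numExt (H : RelStructure) {k m : ℕ} (Φ : List (Atom H (Fin k ⊕ Fin m)))
    (x : Fin k → H.carrier) : ℕ :=
  Nat.card {y : Fin m → H.carrier // ∀ A ∈ Φ, A.Holds (Sum.elim x y)}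

/-- The relation `Q` is `p`-mpp-definable in `H`: it is defined by a formula
`∃^{≡ p} y_1 … y_m, Φ(x, y)`, where `Φ` is a conjunction of atomic formulas over `H` and the
modular quantifier (over all of `y_1, …, y_m` at once) says that the number of satisfying
assignments of `y_1, …, y_m` is not divisible by `p`. -/
def MppDefinable (H : RelStructure) (p : ℕ) {k : ℕ} (Q : Set (Fin k → H.carrier)) : Prop :=
  ∃ (m : ℕ) (Φ : List (Atom H (Fin k ⊕ Fin m))), ∀ x, x ∈ Q ↔ ¬ p ∣ H.numExt Φ x

/-- A set of elements is a `p`-subalgebra if it is `p`-mpp-definable as a unary relation. -/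
def IsModSubalgebra (H : RelStructure) (p : ℕ) (A : Set H.carrier) : Prop :=
  H.MppDefinable p {x : Fin 1 → H.carrier | x 0 ∈ A}

/-! ### The structure `H^f` -/

open Classical in
/-- The structure `H^f` obtained from `H` by means of a binary operation `f` and an element `a`.
The universe is replaced with two domains: `H - {a}` (sort `0`), and `H - B` (sort `1`), where `B`
is the union of the nontrivial orbits of `x ↦ f a x`, so that `H - B` is the set of fixed points of
`x ↦ f a x`. Every relation `R` of `H` is replaced with its restrictions to these domains, one for
each way `τ` of assigning one of the two domains to each coordinate of `R`. -/
noncomputable def splitAt (H : RelStructure) (f : H.carrier → H.carrier → H.carrier)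
    (a : H.carrier) : MultiStructure where
  Srt := Fin 2
  Dom i := {x : H.carrier // if i = 0 then x ≠ a else f a x = x}
  Symb := (R : H.Symb) × (Fin (H.arity R) → Fin 2)
  arity R := H.arity R.1
  arity_pos R := H.arity_pos R.1
  type R := R.2
  rel R := {t | (fun s => (t s).1) ∈ H.rel R.1}

end RelStructure

/-! ## Function problems and polynomial time Turing reductions -/

/-- A computational problem that asks for the value of a function on a given instance. Instances
are presented to an algorithm as words over `ℕ`. -/
structure FunctionProblem where
  /-- the instances -/
  Inst : Type
  /-- the word that represents an instance -/
  encode : Inst → List ℕ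
  encode_injective : Function.Injective encode
  /-- the answer to an instance -/
  answer : Inst → ℕ

/-! The model of computation is the random access machine with addition and (truncated) subtraction
of natural numbers at unit cost and without multiplication, extended by an oracle instruction. It is
given as a structured programming language. A program uses finitely many unbounded arrays of
natural numbers, numbered by `ℕ`; initially all but finitely many cells hold `0`. In `t` steps, such
a machine creates only numbers with `O(t)` more bits than the numbers it has started with, so the
model is polynomially equivalent to (oracle) Turing machines. -/
namespace RAM

/-- The contents of the memory: `s A i` is the `i`-th cell of the array `A`. -/
abbrev Store := ℕ → ℕ → ℕ

/-- Write the number `n` to the `i`-th cell of the array `A`. -/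
def Store.write (s : Store) (A i n : ℕ) : Store :=
  fun A' i' => if A' = A ∧ i' = i then n else s A' i'

/-- Expressions: constants, array cells, addition and truncated subtraction. -/
inductive Expr : Type
  | const (n : ℕ) : Expr
  | get (A : ℕ) (i : Expr) : Expr
  | add (e₁ e₂ : Expr) : Expr
  | sub (e₁ e₂ : Expr) : Expr

/-- The value of an expression. -/
def Expr.eval (s : Store) : Expr → ℕ
  | .const n => n
  | .get A i => s A (i.eval s)
  | .add e₁ e₂ => e₁.eval s + e₂.eval s
  | .sub e₁ e₂ => e₁.eval s - e₂.eval s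

/-- Programs. `assign A i e` is `A[i] := e`, the tests of `ite` and `loop` (a while loop) ask
whether the expression is nonzero, and `query A e B i` submits the word of the first `e` cells of
the array `A` to the oracle and writes its answer to `B[i]`. -/
inductive Prog : Type
  | skip : Prog
  | assign (A : ℕ) (i e : Expr) : Prog
  | seq (P Q : Prog) : Prog
  | ite (e : Expr) (P Q : Prog) : Prog
  | loop (e : Expr) (P : Prog) : Prog
  | query (A : ℕ) (e : Expr) (B : ℕ) (i : Expr) : Prog

/-- `Exec O P s s' t`: with the oracle `O`, the program `P` started in the store `s` halts in the
store `s'` after exactly `t` steps. Assignments and tests take one step each (an expression has a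
size that is fixed by the program), and a query takes one more step than the length of the word
that is submitted. -/
inductive Exec (O : List ℕ → ℕ) : Prog → Store → Store → ℕ → Prop
  | skip (s : Store) : Exec O .skip s s 1
  | assign (A : ℕ) (i e : Expr) (s : Store) :
      Exec O (.assign A i e) s (s.write A (i.eval s) (e.eval s)) 1
  | seq {P Q : Prog} {s s' s'' : Store} {t t' : ℕ} :
      Exec O P s s' t → Exec O Q s' s'' t' → Exec O (.seq P Q) s s'' (t + t')
  | ite_true {e : Expr} {P Q : Prog} {s s' : Store} {t : ℕ} :
      e.eval s ≠ 0 → Exec O P s s' t → Exec O (.ite e P Q) s s' (t + 1)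
  | ite_false {e : Expr} {P Q : Prog} {s s' : Store} {t : ℕ} :
      e.eval s = 0 → Exec O Q s s' t → Exec O (.ite e P Q) s s' (t + 1)
  | loop_done {e : Expr} {P : Prog} {s : Store} :
      e.eval s = 0 → Exec O (.loop e P) s s 1
  | loop_step {e : Expr} {P : Prog} {s s' s'' : Store} {t t' : ℕ} :
      e.eval s ≠ 0 → Exec O P s s' t → Exec O (.loop e P) s' s'' t' →
        Exec O (.loop e P) s s'' (t + t' + 1)
  | query (A : ℕ) (e : Expr) (B : ℕ) (i : Expr) (s : Store) :
      Exec O (.query A e B i) s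
        (s.write B (i.eval s) (O ((List.range (e.eval s)).map (s A)))) (e.eval s + 1)

/-- The initial store on the input word `w`: the word is in array `0`, its length is in the
first cell of array `1`, and all other cells hold `0`. -/
def initStore (w : List ℕ) : Store := fun A i =>
  if A = 0 then w.getD i 0 else if A = 1 ∧ i = 0 then w.length else 0

end RAM

/-- `A` is polynomial time (Turing) reducible to `B`: some program with an oracle for `B` solves `A`
in time polynomial in the length of the input. The program has to work with every oracle that
answers correctly the words which represent instances of `B`, no matter what it answers to other
words. The result is left in the first cell of array `0`. -/
def PolyTimeReducible (A B : FunctionProblem) : Prop :=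
  ∃ (P : RAM.Prog) (T : Polynomial ℕ), ∀ O : List ℕ → ℕ, (∀ y, O (B.encode y) = B.answer y) →
    ∀ x : A.Inst, ∃ (s : RAM.Store) (t : ℕ),
      RAM.Exec O P (RAM.initStore (A.encode x)) s t ∧
        t ≤ T.eval (A.encode x).length ∧ s 0 0 = A.answer x

/-- `A` and `B` are polynomial time interreducible. -/
def PolyTimeInterreducible (A B : FunctionProblem) : Prop :=
  PolyTimeReducible A B ∧ PolyTimeReducible B A

/-! ## Modular counting CSPs -/

namespace MultiStructure

/-- A constraint on the variables `0, …, n - 1` with given sorts: a relation symbol and a tuple of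
variables whose sorts match the type of the symbol. -/
structure Constraint (H : MultiStructure) {n : ℕ} (τ : Fin n → H.Srt) where
  /-- the relation symbol -/
  symb : H.Symb
  /-- the tuple of variables -/
  scope : Fin (H.arity symb) → Fin n
  sort_scope : ∀ s, τ (scope s) = H.type symb s

/-- An instance of the constraint satisfaction problem over `H`: variables `0, …, n - 1`, the sort
of each variable, and a finite list of constraints. Equivalently, a finite structure `G` similar to
`H`, whose elements are the variables, and whose tuples are the constraints. -/
structure Instance (H : MultiStructure) where
  /-- the number of variables -/
  n : ℕ
  /-- the sorts of the variables -/
  τ : Fin n → H.Srt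
  /-- the constraints -/
  constraints : List (H.Constraint τ)

/-- `φ` maps every variable into the domain of its sort and satisfies all the constraints (that is,
it is a homomorphism from the structure `G` given by the instance to `H`). -/
def Instance.IsSolution {H : MultiStructure} (I : H.Instance)
    (φ : (v : Fin I.n) → H.Dom (I.τ v)) : Prop :=
  ∀ c ∈ I.constraints,
    (fun s => cast (congrArg H.Dom (c.sort_scope s)) (φ (c.scope s))) ∈ H.rel c.symb

/-- The number of solutions of an instance. -/
noncomputable def Instance.numSolutions {H : MultiStructure} (I : H.Instance) : ℕ :=
  Nat.card {φ : (v : Fin I.n) → H.Dom (I.τ v) // I.IsSolution φ}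

/-- A constraint as a word: the number of its relation symbol (in a fixed enumeration), followed by
its variables. -/
noncomputable def Constraint.encode {H : MultiStructure} {n : ℕ} {τ : Fin n → H.Srt}
    (c : H.Constraint τ) : List ℕ :=
  (Fintype.equivFin H.Symb c.symb : ℕ) :: List.ofFn (fun s => (c.scope s : ℕ))

/-- An instance as a word: the number `n` of its variables, the numbers of their `n` sorts (in a
fixed enumeration of the sorts), and the words of its constraints. All entries are bounded by the
length of the word or by a constant that depends on `H` only, so the length of the word is
polynomially equivalent to the size of a binary representation of the instance. -/
noncomputable def Instance.encode {H : MultiStructure} (I : H.Instance) : List ℕ :=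
  I.n :: (List.ofFn (fun v => (Fintype.equivFin H.Srt (I.τ v) : ℕ)) ++
    I.constraints.flatMap Constraint.encode)

theorem Constraint.encode_append_inj {H : MultiStructure} {n : ℕ} {τ : Fin n → H.Srt}
    {c d : H.Constraint τ} {u v : List ℕ} (h : c.encode ++ u = d.encode ++ v) :
    c = d ∧ u = v := by
  obtain ⟨R, z, hz⟩ := c
  obtain ⟨R', z', hz'⟩ := d
  simp only [Constraint.encode, List.cons_append, List.cons.injEq] at h
  obtain ⟨h₁, h₂⟩ := h
  obtain rfl : R = R' := (Fintype.equivFin H.Symb).injective (Fin.ext h₁)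
  obtain ⟨h₃, h₄⟩ := List.append_inj h₂ (by simp)
  obtain rfl : z = z' := by
    funext s
    exact Fin.ext (congrFun (List.ofFn_injective h₃) s)
  exact ⟨rfl, h₄⟩

theorem Instance.encode_injective (H : MultiStructure) :
    Function.Injective (Instance.encode (H := H)) := by
  rintro ⟨n, τ, C⟩ ⟨n', τ', C'⟩ h
  simp only [Instance.encode, List.cons.injEq] at h
  obtain ⟨h₁, h₂⟩ := h
  subst h₁
  obtain ⟨h₃, h₄⟩ := List.append_inj h₂ (by simp)
  obtain rfl : τ = τ' := by
    funext v
    exact (Fintype.equivFin H.Srt).injective (Fin.ext (congrFun (List.ofFn_injective h₃) v))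
  obtain rfl : C = C' := by
    clear h₂ h₃
    induction C generalizing C' with
    | nil =>
      cases C' with
      | nil => rfl
      | cons d D => simp [Constraint.encode] at h₄
    | cons c C ih =>
      cases C' with
      | nil => simp [Constraint.encode] at h₄
      | cons d D =>
        rw [List.flatMap_cons, List.flatMap_cons] at h₄
        obtain ⟨rfl, h₅⟩ := Constraint.encode_append_inj h₄
        rw [ih D h₅]
  rfl

/-- The problem `#_p CSP(H)`: given an instance, find the number of its solutions modulo `p`. -/
noncomputable def modCSP (H : MultiStructure) (p : ℕ) : FunctionProblem where
  Inst := H.Instance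
  encode := Instance.encode
  encode_injective := Instance.encode_injective H
  answer I := I.numSolutions % p

end MultiStructure

/-! ### Total correctness with time bounds for oracle programs, and program combinators. -/

namespace RAM

/-! The constants make `f` idempotent, so the order-2 permutation τ = `f a` fixes `a` and, as there
are only three elements, swaps the other two. For x ≠ `a` the map `f x` is the identity: otherwise
it would exchange `a` with an element of `H` - {a}, while `f`, being an injective action on
satisfying tuples, forces the formula defining `H` - {a} to have equally many witnesses at both
(`numExt_le_of_polymorphism`, `eq_ite`). So `f` flips its second argument by τ exactly where its
first argument is `a`.

From `H` to `H.splitAt f a`. For F : variables → ℤ/2, let the flip by F apply τ on the support of F.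
The flips preserving a relation form a subspace, given by linear equations that depend on the
relation only. Imposing these equations on every constraint of an instance yields a subspace W of
flips preserving the solution set. Two facts relate W to the element `a`. For a solution φ, the map
ψ ↦ f(φ, ψ) is the flip by the indicator of φ⁻¹(a) and preserves every relation, so this indicator
lies in W; hence no solution takes the value `a` outside the union of the supports of W. And
generators of W act on the solutions as commuting involutions, so modulo 2 only the solutions fixed
by all of them count; these take the value `a`, the only fixed point of τ, on the whole union of
supports. The number of solutions is thus congruent to that of the same instance with sort 1 on the
union of supports and sort 0 elsewhere (`numSolutions_mod_two_eq`). The union is computed by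
Gaussian elimination: generators of W come from the identity matrix by cutting with one equation at
a time (`ElimInv.span_eq`).

From `H.splitAt f a` to `H`. Each variable receives a private gadget whose number of extensions is
odd exactly on the domain of its sort: the formula for `H` - {a}, or the constant relation of `a`.
The merged count is a sum over assignments of products of gadget counts, so modulo 2 exactly the
well-sorted solutions remain (`numSolutions_mergeInstance`).

Both reductions make a single query and are written as explicit programs, verified by a small Hoare
calculus (`Run`). The arrays are: 0, 1 input and its length; 2, 3 output word and its length; 4
position in the input; 5, 6 counters; 7, 8 row addresses and matrix; 9, 10 pivot row and pivot flag;
11 sorts. -/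

theorem Store.write_of_ne (s : Store) {A A' : ℕ} (i n : ℕ) (h : A' ≠ A) :
    s.write A i n A' = s A' := by
  funext i'
  simp [Store.write, h]

theorem Store.write_self (s : Store) (A i n : ℕ) :
    s.write A i n A = Function.update (s A) i n := by
  funext i'
  simp [Store.write, Function.update_apply]

/-- Total correctness within a time bound: `P` started in `s` halts after at most `T` steps in a
store that satisfies `Q`. -/
def Run (O : List ℕ → ℕ) (P : Prog) (s : Store) (T : ℕ) (Q : Store → Prop) : Prop :=
  ∃ s' t, Exec O P s s' t ∧ t ≤ T ∧ Q s'

variable {O : List ℕ → ℕ}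

theorem Run.mono {P : Prog} {s : Store} {T T' : ℕ} {Q Q' : Store → Prop}
    (h : Run O P s T Q) (hT : T ≤ T') (hQ : ∀ s', Q s' → Q' s') : Run O P s T' Q' := by
  obtain ⟨s', t, h₁, h₂, h₃⟩ := h
  exact ⟨s', t, h₁, h₂.trans hT, hQ _ h₃⟩

theorem Run.skip {s : Store} {Q : Store → Prop} (h : Q s) : Run O .skip s 1 Q :=
  ⟨s, 1, .skip s, le_rfl, h⟩

theorem Run.assign {A : ℕ} {i e : Expr} {s : Store} {Q : Store → Prop}
    (h : Q (s.write A (i.eval s) (e.eval s))) : Run O (.assign A i e) s 1 Q :=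
  ⟨_, 1, .assign A i e s, le_rfl, h⟩

theorem Run.seq {P P' : Prog} {s : Store} {T T' : ℕ} {Q : Store → Prop}
    (h : Run O P s T fun s' => Run O P' s' T' Q) : Run O (.seq P P') s (T + T') Q := by
  obtain ⟨s', t, h₁, h₂, s'', t', h₃, h₄, h₅⟩ := h
  exact ⟨s'', t + t', .seq h₁ h₃, add_le_add h₂ h₄, h₅⟩

theorem Run.ite {e : Expr} {P P' : Prog} {s : Store} {T : ℕ} {Q : Store → Prop}
    (h₁ : e.eval s ≠ 0 → Run O P s T Q) (h₂ : e.eval s = 0 → Run O P' s T Q) :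
    Run O (.ite e P P') s (T + 1) Q := by
  by_cases he : e.eval s = 0
  · obtain ⟨s', t, h₃, h₄, h₅⟩ := h₂ he
    exact ⟨s', t + 1, .ite_false he h₃, by omega, h₅⟩
  · obtain ⟨s', t, h₃, h₄, h₅⟩ := h₁ he
    exact ⟨s', t + 1, .ite_true he h₃, by omega, h₅⟩

theorem Run.query {A B : ℕ} {e i : Expr} {s : Store} {Q : Store → Prop}
    (h : Q (s.write B (i.eval s) (O ((List.range (e.eval s)).map (s A))))) :
    Run O (.query A e B i) s (e.eval s + 1) Q :=
  ⟨_, _, .query A e B i s, le_rfl, h⟩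

/-- A while loop that makes exactly `N - i` iterations when it is started in a store that satisfies
`I i`. -/
theorem Run.loop {e : Expr} {P : Prog} {N Tb : ℕ} (I : ℕ → Store → Prop)
    (he : ∀ i s, i < N → I i s → e.eval s ≠ 0) (he' : ∀ s, I N s → e.eval s = 0)
    (hb : ∀ i s, i < N → I i s → Run O P s Tb (I (i + 1))) {i : ℕ} (hi : i ≤ N) {s : Store}
    (hs : I i s) : Run O (.loop e P) s ((N - i) * (Tb + 1) + 1) (I N) := by
  obtain ⟨d, rfl⟩ := Nat.exists_eq_add_of_le hi
  induction d generalizing i s with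
  | zero =>
    exact ⟨s, 1, .loop_done (he' s hs), by omega, hs⟩
  | succ d ih =>
    obtain ⟨s', t, h₁, h₂, h₃⟩ := hb i s (by omega) hs
    have hd : i + 1 + d = i + (d + 1) := by omega
    obtain ⟨s'', t', h₄, h₅, h₆⟩ := ih (i := i + 1) (s := s') h₃ (by rwa [hd]) (by rwa [hd])
      (by rwa [hd]) (by omega)
    refine ⟨s'', t + t' + 1, .loop_step (he i s (by omega) hs) h₁ h₄, ?_, by rwa [hd] at h₆⟩
    rw [show i + 1 + d - (i + 1) = d by omega] at h₅
    rw [show i + (d + 1) - i = d + 1 by omega]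
    calc t + t' + 1 ≤ Tb + (d * (Tb + 1) + 1) + 1 := by omega
      _ = (d + 1) * (Tb + 1) + 1 := by ring

/-- The first cell of an array, used as a scalar variable. -/
abbrev scal (A : ℕ) : Expr := .get A (.const 0)

/-- `for c[0] = 0, …, bound - 1 do body`. -/
def forLoop (c : ℕ) (bound : Expr) (body : Prog) : Prog :=
  .seq (.assign c (.const 0) (.const 0))
    (.loop (.sub bound (scal c))
      (.seq body (.assign c (.const 0) (.add (scal c) (.const 1)))))

/-- The invariant `I i` speaks of the store after the counter has been set to `i`, hence the
explicit writes to `c`. The bound is re-evaluated at every test, so it must be constant under the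
invariant. An iteration costs the body, the increment and the test; the final 2 is the
initialization and the failing test. -/
theorem Run.forLoop {c : ℕ} {bound : Expr} {body : Prog} {N Tb : ℕ} (I : ℕ → Store → Prop)
    (hbound : ∀ i s, I i s → bound.eval s = N)
    (hb : ∀ i s, i < N → I i s → s c 0 = i →
      Run O body s Tb fun s' => s' c 0 = i ∧ I (i + 1) (s'.write c 0 (i + 1)))
    {s : Store} (hs : I 0 (s.write c 0 0)) {Q : Store → Prop} (hQ : ∀ s', I N s' → Q s') :
    Run O (forLoop c bound body) s (N * (Tb + 2) + 2) Q := by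
  have key : Run O (.loop (.sub bound (scal c))
      (.seq body (.assign c (.const 0) (.add (scal c) (.const 1))))) (s.write c 0 0)
      ((N - 0) * (Tb + 1 + 1) + 1) (fun s' => I N s' ∧ s' c 0 = N) := by
    refine Run.loop (fun i s' => I i s' ∧ s' c 0 = i) ?_ ?_ ?_ (Nat.zero_le N)
      ⟨hs, by simp [Store.write]⟩
    · rintro i s' hi ⟨h₁, h₂⟩
      simp [Expr.eval, hbound i s' h₁, h₂]
      omega
    · rintro s' ⟨h₁, h₂⟩
      simp [Expr.eval, hbound N s' h₁, h₂]
    · rintro i s' hi ⟨h₁, h₂⟩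
      refine Run.seq ((hb i s' hi h₁ h₂).mono le_rfl ?_)
      rintro s'' ⟨h₃, h₄⟩
      refine Run.assign ?_
      simp only [Expr.eval, h₃]
      exact ⟨h₄, by simp [Store.write]⟩
  refine (Run.seq (Run.assign key)).mono ?_ fun s' h => hQ s' h.1
  simp only [Nat.sub_zero]
  linarith

/-- Run the program that is paired with the first test that evaluates to `0`. -/
def dispatch : List (Expr × Prog) → Prog
  | [] => .skip
  | b :: l => .ite b.1 (dispatch l) b.2

/-- The tests need not be exclusive: one must succeed, and every branch whose test succeeds must be
correct. -/
theorem Run.dispatch {l : List (Expr × Prog)} {s : Store} {T : ℕ} {Q : Store → Prop}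
    (hex : ∃ b ∈ l, b.1.eval s = 0) (h : ∀ b ∈ l, b.1.eval s = 0 → Run O b.2 s T Q) :
    Run O (dispatch l) s (T + l.length) Q := by
  induction l with
  | nil => simp at hex
  | cons b l ih =>
    rw [List.length_cons, ← add_assoc]
    refine Run.ite (fun hb => ih ?_ fun b' hb' => h b' (List.mem_cons_of_mem _ hb'))
      fun hb => (h b List.mem_cons_self hb).mono (Nat.le_add_right _ _) fun _ => id
    obtain ⟨b', hb', h0⟩ := hex
    rcases List.mem_cons.1 hb' with rfl | hb'
    · exact absurd h0 hb
    · exact ⟨b', hb', h0⟩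

/-- An expression that evaluates to `0` if and only if the two arguments are equal. -/
def neq (e e' : Expr) : Expr := .add (.sub e e') (.sub e' e)

theorem eval_neq (e e' : Expr) (s : Store) : (neq e e').eval s = 0 ↔ e.eval s = e'.eval s := by
  simp only [neq, Expr.eval]
  omega

/-- The sum of a list of expressions. -/
def sumExpr : List Expr → Expr
  | [] => .const 0
  | e :: l => .add e (sumExpr l)

/-- Since `0` stands for success, addition of natural numbers is conjunction of tests. -/
theorem eval_sumExpr_eq_zero (l : List Expr) (s : Store) :
    (sumExpr l).eval s = 0 ↔ ∀ e ∈ l, e.eval s = 0 := by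
  induction l with
  | nil => simp [sumExpr, Expr.eval]
  | cons e l ih => simp [sumExpr, Expr.eval, ih]

/-- The sum of `k` copies of an expression. -/
def mulExpr (k : ℕ) (e : Expr) : Expr := sumExpr (List.replicate k e)

theorem eval_mulExpr (k : ℕ) (e : Expr) (s : Store) : (mulExpr k e).eval s = k * e.eval s := by
  induction k with
  | zero => simp [mulExpr, sumExpr, Expr.eval]
  | succ k ih =>
    simp only [mulExpr, List.replicate_succ, sumExpr, Expr.eval] at ih ⊢
    rw [ih]
    ring

/-- Sequential composition of a list of programs. -/
def seqAll : List Prog → Prog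
  | [] => .skip
  | P :: l => .seq P (seqAll l)

theorem Run.seqAll {ι : Type*} {F : ι → Prog} {T : ℕ} (I : List ι → Store → Prop)
    {l done : List ι} {s : Store} (hs : I done s)
    (hb : ∀ d x s, I d s → x ∈ l → Run O (F x) s T (I (d ++ [x]))) :
    Run O (seqAll (l.map F)) s (l.length * T + 1) (I (done ++ l)) := by
  induction l generalizing done s with
  | nil => exact (Run.skip (by simpa using hs)).mono (by simp) fun _ => id
  | cons x l ih =>
    refine (Run.seq ((hb done x s hs List.mem_cons_self).mono le_rfl fun s' hs' =>
      ih hs' fun d y s hd hy => hb d y s hd (List.mem_cons_of_mem _ hy))).mono ?_ fun s' h => ?_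
    · simp only [List.length_cons]
      linarith
    · simpa using h

/-! ### Output words: the word is kept in array `2` and its length in the first cell of array `3`. -/

/-- The output word written so far is `l`. -/
def Out (s : Store) (l : List ℕ) : Prop := (List.range (s 3 0)).map (s 2) = l

/-- The stores agree except for the output word. -/
def AgreeOffOut (s s' : Store) : Prop := ∀ A, A ≠ 2 → A ≠ 3 → s' A = s A

/-- Append the value of an expression to the output word. -/
def push (e : Expr) : Prog :=
  .seq (.assign 2 (scal 3) e) (.assign 3 (.const 0) (.add (scal 3) (.const 1)))

theorem Run.push {e : Expr} {s : Store} {l : List ℕ} (hl : Out s l) {Q : Store → Prop}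
    (hQ : ∀ s', AgreeOffOut s s' → Out s' (l ++ [e.eval s]) → Q s') : Run O (push e) s 2 Q := by
  refine Run.seq (Run.assign (Run.assign (hQ _ ?_ ?_)))
  · intro A h2 h3
    rw [Store.write_of_ne _ _ _ h3, Store.write_of_ne _ _ _ h2]
  · subst hl
    simp only [Out, Expr.eval]
    rw [show ∀ s : Store, ∀ n, (s.write 3 0 n) 3 0 = n from fun s n => by simp [Store.write],
      Store.write_of_ne _ _ _ (show 2 ≠ 3 by decide), Store.write_self,
      Store.write_of_ne _ _ _ (show 3 ≠ 2 by decide), List.range_succ, List.map_append]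
    congr 1
    · refine List.map_congr_left fun i hi => ?_
      rw [Function.update_of_ne (List.mem_range.1 hi).ne]
    · simp

/-- Append the values of expressions to the output word. -/
def pushAll (es : List Expr) : Prog := seqAll (es.map push)

/-- The expressions are evaluated one after another while the output grows, so their values must not
depend on arrays 2 and 3. -/
theorem Run.pushAll {es : List Expr} {s : Store} {l : List ℕ} (hl : Out s l)
    (hes : ∀ e ∈ es, ∀ s', AgreeOffOut s s' → e.eval s' = e.eval s) {Q : Store → Prop}
    (hQ : ∀ s', AgreeOffOut s s' → Out s' (l ++ es.map fun e => e.eval s) → Q s') :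
    Run O (pushAll es) s (es.length * 2 + 1) Q := by
  refine (Run.seqAll (F := RAM.push) (l := es) (done := []) (T := 2)
    (fun d s' => AgreeOffOut s s' ∧ Out s' (l ++ d.map fun e => e.eval s))
    ⟨fun _ _ _ => rfl, by simpa using hl⟩ ?_).mono le_rfl fun s' hs' => hQ s' hs'.1 hs'.2
  rintro d e s' ⟨h₁, h₂⟩ he
  refine Run.push h₂ fun s'' h₃ h₄ => ⟨fun A h2 h3 => (h₃ A h2 h3).trans (h₁ A h2 h3), ?_⟩
  rw [hes e he s' h₁] at h₄
  simpa using h₄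

end RAM

/-! ### The shape of the automorphic polynomial. -/

namespace RelStructure

variable {H : RelStructure} {f : H.carrier → H.carrier → H.carrier} {a : H.carrier}

/-- A polymorphism preserves the constant relation {x}. -/
theorem HasConstants.idempotent (hconst : H.HasConstants) (hf : H.IsBinaryPolymorphism f)
    (x : H.carrier) : f x x = x := by
  obtain ⟨R, hR, hx⟩ := hconst x
  have h := hf R (fun _ => x) (by rw [hx]; exact fun _ => rfl) (fun _ => x)
    (by rw [hx]; exact fun _ => rfl)
  rw [hx] at h
  exact h ⟨0, by omega⟩

theorem IsBinaryPolymorphism.atom_holds (hf : H.IsBinaryPolymorphism f) {X : Type}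
    {u v : X → H.carrier} {A : Atom H X} (hu : A.Holds u) (hv : A.Holds v) :
    A.Holds fun x => f (u x) (v x) := by
  cases A with
  | eq y z =>
    simp only [Atom.Holds] at *
    rw [hu, hv]
  | rel R z => exact hf R _ hu _ hv

/-- Fix one satisfying tuple `u` at `x`. Then v ↦ f(u, v), taken coordinatewise, sends satisfying
tuples at `y` to satisfying tuples at f(x, y), and it is injective because each `f (u j)` is. -/
theorem numExt_le_of_polymorphism (hf : H.IsBinaryPolymorphism f)
    (hinj : ∀ x, Function.Injective (f x)) {k m : ℕ} (Φ : List (Atom H (Fin k ⊕ Fin m)))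
    {x y : Fin k → H.carrier} (hx : H.numExt Φ x ≠ 0) :
    H.numExt Φ y ≤ H.numExt Φ fun s => f (x s) (y s) := by
  classical
  obtain ⟨⟨u, hu⟩⟩ : Nonempty {u : Fin m → H.carrier // ∀ A ∈ Φ, A.Holds (Sum.elim x u)} := by
    by_contra h
    rw [not_nonempty_iff] at h
    exact hx Nat.card_of_isEmpty
  refine Nat.card_le_card_of_injective
    (fun v => ⟨fun j => f (u j) (v.1 j), fun A hA => ?_⟩) fun v w h => ?_
  · convert hf.atom_holds (hu A hA) (v.2 A hA) using 1
    funext z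
    cases z <;> rfl
  · refine Subtype.ext (funext fun j => hinj (u j) ?_)
    exact congrFun (congrArg Subtype.val h) j

theorem IsAutomorphicPolynomial.involutive (hf : H.IsAutomorphicPolynomial 2 f) (x y : H.carrier) :
    f x (f x y) = y := by
  rcases hf.2.1 x with h | ⟨σ, h, hσ⟩
  · rw [h, h]
  · have h2 : σ ^ 2 = 1 := hσ ▸ pow_orderOf_eq_one σ
    rw [← h, ← h, ← Equiv.Perm.mul_apply, ← sq, h2, Equiv.Perm.one_apply]

/-- The elements that act as the identity and the element that acts as a transposition, for a
`2`-automorphic polynomial of a structure with three elements and all constants. -/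
theorem IsAutomorphicPolynomial.eq_ite (hcard : Fintype.card H.carrier = 3)
    (hconst : H.HasConstants) (hf : H.IsAutomorphicPolynomial 2 f) (ha : IsPermOfOrder 2 (f a))
    (hsub : H.IsModSubalgebra 2 {x | x ≠ a}) :
    (∀ x, f a x = x ↔ x = a) ∧ ∀ x, x ≠ a → ∀ y, f x y = y := by
  classical
  have hid := hconst.idempotent hf.1
  have hinv := hf.involutive
  have hinj : ∀ x, Function.Injective (f x) := fun x => Function.Involutive.injective (hinv x)
  have three : ∀ x y : H.carrier, x ≠ y → ∃ z, z ≠ x ∧ z ≠ y ∧ ∀ w, w = x ∨ w = y ∨ w = z := by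
    intro x y hxy
    have h1 : (Finset.univ \ {x, y} : Finset H.carrier).card = 1 := by
      rw [Finset.card_sdiff_of_subset (Finset.subset_univ _), Finset.card_pair hxy,
        Finset.card_univ, hcard]
    obtain ⟨z, hz⟩ := Finset.card_eq_one.1 h1
    have hz' : ∀ w, w = z ↔ ¬ (w = x ∨ w = y) := by
      intro w
      rw [← Finset.mem_singleton, ← hz]
      simp
    refine ⟨z, fun h => (hz' z).1 rfl (.inl h), fun h => (hz' z).1 rfl (.inr h), fun w => ?_⟩
    rw [hz' w]
    tauto
  -- A permutation of three elements with two fixed points is the identity.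
  have fix2 : ∀ u x y : H.carrier, x ≠ y → f u x = x → f u y = y → ∀ z, f u z = z := by
    intro u x y hxy hx hy z
    obtain ⟨w, hwx, hwy, hw⟩ := three x y hxy
    rcases hw z with rfl | rfl | rfl
    · exact hx
    · exact hy
    · rcases hw (f u z) with h | h | h
      · exact absurd (hinj u (h.trans hx.symm)) hwx
      · exact absurd (hinj u (h.trans hy.symm)) hwy
      · exact h
  refine ⟨fun x => ⟨fun hx => ?_, fun hx => hx ▸ hid a⟩, fun x hx => ?_⟩
  · by_contra hxa
    obtain ⟨σ, hσ, hord⟩ := ha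
    have : σ = 1 := Equiv.ext fun z => (hσ z).trans (fix2 a x a hxa hx (hid a) z)
    rw [this, orderOf_one] at hord
    omega
  · refine fix2 x x a hx (hid x) ?_
    by_contra hne
    obtain ⟨m, Φ, hΦ⟩ := hsub
    have hodd : ∀ z, z ≠ a ↔ ¬ 2 ∣ H.numExt Φ fun _ => z := fun z => hΦ fun _ => z
    have hx0 : H.numExt Φ (fun _ => x) ≠ 0 := fun h0 => (hodd x).1 hx (h0 ▸ dvd_zero 2)
    -- Since `f x` is an involution, applying the inequality at `a` and at `f x a` closes a circle:
    -- both have the same number of witnesses, although only `f x a` belongs to the set defined by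
    -- `Φ`.
    have h1 := numExt_le_of_polymorphism hf.1 hinj Φ (y := fun _ => a) hx0
    have h2 := numExt_le_of_polymorphism hf.1 hinj Φ (y := fun _ => f x a) hx0
    simp only [hinv] at h2
    have h3 := (hodd _).1 hne
    rw [← le_antisymm h1 h2] at h3
    exact (hodd a).2 h3 rfl

end RelStructure

/-! ### Flips and counting modulo 2. -/

/-- The function `φ` with `τ` applied to its values at the points of the support of `F`. -/
def flip₂ {X C : Type} (τ : C → C) (F : X → ZMod 2) (φ : X → C) : X → C :=
  fun x => if F x = 0 then φ x else τ (φ x)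

section Flip

variable {X C : Type} {τ : C → C}

theorem flip₂_flip₂ (hτ : Function.Involutive τ) (F G : X → ZMod 2) (φ : X → C) :
    flip₂ τ F (flip₂ τ G φ) = flip₂ τ (F + G) φ := by
  funext x
  simp only [flip₂, Pi.add_apply]
  have h2 : ∀ u : ZMod 2, u = 0 ∨ u = 1 := by decide
  have h11 : (1 + 1 : ZMod 2) = 0 := by decide
  rcases h2 (F x) with hF | hF <;> rcases h2 (G x) with hG | hG <;> simp [hF, hG, hτ _, h11]

theorem flip₂_zero (φ : X → C) : flip₂ τ 0 φ = φ := by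
  funext x
  simp [flip₂]

theorem flip₂_eq_self_iff {F : X → ZMod 2} {φ : X → C} :
    flip₂ τ F φ = φ ↔ ∀ x, F x ≠ 0 → τ (φ x) = φ x := by
  rw [funext_iff]
  refine forall_congr' fun x => ?_
  by_cases h : F x = 0 <;> simp [flip₂, h]

/-- The flips that preserve a set of functions. -/
def flipModule (τ : C → C) (hτ : Function.Involutive τ) (S : Set (X → C)) :
    Submodule (ZMod 2) (X → ZMod 2) where
  carrier := {F | ∀ φ ∈ S, flip₂ τ F φ ∈ S}
  zero_mem' φ hφ := by rwa [flip₂_zero]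
  add_mem' {F G} hF hG φ hφ := by
    rw [← flip₂_flip₂ hτ]
    exact hF _ (hG _ hφ)
  smul_mem' c F hF φ hφ := by
    have h2 : ∀ u : ZMod 2, u = 0 ∨ u = 1 := by decide
    rcases h2 c with rfl | rfl
    · rwa [zero_smul, flip₂_zero]
    · rw [one_smul]
      exact hF φ hφ

/-- The flip by `F` is an involution of `S`, because F + F = 0; the elements that it moves come in
pairs. -/
theorem card_modEq_card_fixed [Finite X] [Finite C] (hτ : Function.Involutive τ)
    (S : Set (X → C)) {F : X → ZMod 2} (hF : ∀ φ ∈ S, flip₂ τ F φ ∈ S) :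
    Nat.card S ≡ Nat.card {φ | φ ∈ S ∧ flip₂ τ F φ = φ} [MOD 2] := by
  classical
  have := Fintype.ofFinite S
  let g : S → S := fun φ => ⟨flip₂ τ F φ.1, hF _ φ.2⟩
  have hg : (show Function.End S from g) ^ 2 ^ 1 = 1 := by
    rw [pow_one, sq]
    funext φ
    refine Subtype.ext ?_
    change flip₂ τ F (flip₂ τ F φ.1) = φ.1
    rw [flip₂_flip₂ hτ, show F + F = 0 from funext fun x => CharTwo.add_self_eq_zero _, flip₂_zero]
  have h := Equiv.Perm.card_fixedPoints_modEq (p := 2) (n := 1) hg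
  rw [← Nat.card_eq_fintype_card, ← Nat.card_eq_fintype_card] at h
  refine h.trans (congrArg (· % 2) (Nat.card_congr ?_))
  refine ⟨fun φ => ⟨φ.1.1, φ.1.2, congrArg Subtype.val φ.2⟩,
    fun φ => ⟨⟨φ.1, φ.2.1⟩, Subtype.ext φ.2.2⟩, fun _ => rfl, fun _ => rfl⟩

/-- Modulo `2`, a set of functions has as many elements as its subset of functions fixed by given
flips that preserve the set. -/
theorem card_modEq_card_fixed_list [Finite X] [Finite C] (hτ : Function.Involutive τ)
    (S : Set (X → C)) (W : List (X → ZMod 2)) (hW : ∀ F ∈ W, ∀ φ ∈ S, flip₂ τ F φ ∈ S) :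
    Nat.card S ≡ Nat.card {φ | φ ∈ S ∧ ∀ F ∈ W, flip₂ τ F φ = φ} [MOD 2] := by
  induction W generalizing S with
  | nil => simpa using Nat.ModEq.refl _
  | cons F W ih =>
    refine (card_modEq_card_fixed hτ S (hW F List.mem_cons_self)).trans ?_
    refine (ih _ ?_).trans (congrArg (· % 2) ?_)
    -- Flips commute, so `G` preserves the subset fixed by `F`, and the induction hypothesis applies
    -- to that subset.
    · rintro G hG φ ⟨hφ, hfix⟩
      refine ⟨hW G (List.mem_cons_of_mem _ hG) φ hφ, ?_⟩
      rw [flip₂_flip₂ hτ, add_comm, ← flip₂_flip₂ hτ, hfix]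
    · simp only [List.forall_mem_cons, Set.mem_ofPred_eq, and_assoc]

end Flip

/-- A subspace is cut out by linear equations. -/
theorem Submodule.exists_equations {ι : Type} [Fintype ι] (W : Submodule (ZMod 2) (ι → ZMod 2)) :
    ∃ L : List (ι → ZMod 2), ∀ F, F ∈ W ↔ ∀ c ∈ L, ∑ i, c i * F i = 0 := by
  classical
  -- The list consists of all vectors orthogonal to `W`; there are finitely many over a finite
  -- field.
  refine ⟨(Finset.univ.filter fun c : ι → ZMod 2 => ∀ F ∈ W, ∑ i, c i * F i = 0).toList,
    fun F => ⟨fun hF c hc => ?_, fun h => ?_⟩⟩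
  · exact (Finset.mem_filter.1 (Finset.mem_toList.1 hc)).2 F hF
  · by_contra hF
    -- A linear form that vanishes on `W` but not at `F`; its coefficient vector is one of the
    -- listed equations.
    obtain ⟨ℓ, hℓ, hW⟩ := Submodule.exists_le_ker_of_notMem hF
    have hsum : ∀ G, ∑ i, ℓ (Pi.single i 1) * G i = ℓ G := by
      intro G
      rw [LinearMap.pi_apply_eq_sum_univ ℓ G]
      refine Finset.sum_congr rfl fun i _ => ?_
      rw [smul_eq_mul, mul_comm]
      congr 2
      funext j
      simp [Pi.single_apply, eq_comm]
    refine hℓ ?_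
    rw [← hsum F]
    refine h (fun i => ℓ (Pi.single i 1)) 
      (Finset.mem_toList.2 (Finset.mem_filter.2 ⟨Finset.mem_univ _, fun G hG => ?_⟩))
    rw [hsum G]
    exact hW hG

/-! ### Elimination of one linear equation from a generating family -/

section Elimination

variable {V ι : Type} [AddCommGroup V] [Module (ZMod 2) V]

/-- The rows `M k`, `k < i`, have been made to satisfy the equation `ℓ = 0`; `fl` tells whether a
pivot `P` has been found. -/
def ElimInv {n : ℕ} (K : Submodule (ZMod 2) V) (ℓ : V →ₗ[ZMod 2] ZMod 2) (i : ℕ) (M : Fin n → V)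
    (P : V) (fl : ℕ) : Prop :=
  (∀ k : Fin n, (k : ℕ) < i → ℓ (M k) = 0) ∧
    (fl = 0 ∧ Submodule.span (ZMod 2) (Set.range M) = K ∨
      fl = 1 ∧ ℓ P = 1 ∧ Submodule.span (ZMod 2) (Set.range M ∪ {P}) = K)

/-- As long as `P` is kept among the generators, adding it to a row is reversible. -/
theorem span_range_update_add_union [DecidableEq ι] (M : ι → V) (i : ι) (P : V) :
    Submodule.span (ZMod 2) (Set.range (Function.update M i (M i + P)) ∪ {P}) =
      Submodule.span (ZMod 2) (Set.range M ∪ {P}) := by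
  refine le_antisymm ?_ ?_ <;> rw [Submodule.span_le] <;> rintro x (⟨k, rfl⟩ | rfl)
  · by_cases hk : k = i
    · subst hk
      rw [Function.update_self]
      exact add_mem (Submodule.subset_span (.inl ⟨k, rfl⟩)) (Submodule.subset_span (.inr rfl))
    · rw [Function.update_of_ne hk]
      exact Submodule.subset_span (.inl ⟨k, rfl⟩)
  · exact Submodule.subset_span (.inr rfl)
  · by_cases hk : k = i
    · subst hk
      have h := sub_mem (Submodule.subset_span (R := ZMod 2) (.inl ⟨k, rfl⟩))
        (Submodule.subset_span (s := Set.range (Function.update M k (M k + P)) ∪ {P}) (.inr rfl))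
      rwa [Function.update_self, add_sub_cancel_right] at h
    · exact Submodule.subset_span (.inl ⟨k, Function.update_of_ne hk _ _⟩)
  · exact Submodule.subset_span (.inr rfl)

variable {n : ℕ} {K : Submodule (ZMod 2) V} {ℓ : V →ₗ[ZMod 2] ZMod 2} {M : Fin n → V} {P : V}

theorem ElimInv.zero (h : Submodule.span (ZMod 2) (Set.range M) = K) : ElimInv K ℓ 0 M P 0 :=
  ⟨fun _ h => absurd h (Nat.not_lt_zero _), .inl ⟨rfl, h⟩⟩

theorem ElimInv.step_of_eq_zero {i : Fin n} {fl : ℕ} (h : ElimInv K ℓ i M P fl)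
    (hi : ℓ (M i) = 0) : ElimInv K ℓ (i + 1) M P fl := by
  refine ⟨fun k hk => ?_, h.2⟩
  rcases Nat.lt_succ_iff_lt_or_eq.1 hk with hk | hk
  · exact h.1 k hk
  · rwa [Fin.ext hk]

/-- Both the row and the pivot have value 1 under `ℓ`, and 1 + 1 = 0. -/
theorem ElimInv.step {i : Fin n} (h : ElimInv K ℓ i M P 1) (hi : ℓ (M i) = 1) :
    ElimInv K ℓ (i + 1) (Function.update M i (M i + P)) P 1 := by
  obtain ⟨h₁, ⟨h₂, -⟩ | ⟨-, hP, h₂⟩⟩ := h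
  · exact absurd h₂ one_ne_zero
  refine ⟨fun k hk => ?_, .inr ⟨rfl, hP, by rw [span_range_update_add_union, h₂]⟩⟩
  by_cases hki : k = i
  · subst hki
    rw [Function.update_self, map_add, hi, hP]
    decide
  · rw [Function.update_of_ne hki]
    refine h₁ k (lt_of_le_of_ne (Nat.lt_succ_iff.1 hk) fun h => hki (Fin.ext h))

/-- The pivot is a copy of row `i`, which stays in the matrix for now; the next step adds the pivot
to it and turns it into zero. The number of rows therefore never changes. -/
theorem ElimInv.pivot {i : Fin n} (h : ElimInv K ℓ i M P 0) (hi : ℓ (M i) = 1) :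
    ElimInv K ℓ i M (M i) 1 := by
  obtain ⟨h₁, ⟨-, h₂⟩ | ⟨h₂, -⟩⟩ := h
  · refine ⟨h₁, .inr ⟨rfl, hi, ?_⟩⟩
    rw [Set.union_eq_self_of_subset_right
      (Set.singleton_subset_iff.2 (Set.mem_range_self i)), h₂]
  · exact absurd h₂ zero_ne_one

/-- If there is no pivot, all of `K` satisfies the equation already. Otherwise an element of `K` is
y + cP with `y` in the span of the rows and ℓ(y) = 0, and ℓ(P) = 1 forces c = 0 on the kernel. -/
theorem ElimInv.span_eq {fl : ℕ} (h : ElimInv K ℓ n M P fl) :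
    Submodule.span (ZMod 2) (Set.range M) = K ⊓ LinearMap.ker ℓ := by
  have hle : Submodule.span (ZMod 2) (Set.range M) ≤ LinearMap.ker ℓ := by
    rw [Submodule.span_le]
    rintro _ ⟨k, rfl⟩
    exact h.1 k k.2
  rcases h.2 with ⟨-, rfl⟩ | ⟨-, hP, rfl⟩
  · exact (inf_eq_left.2 hle).symm
  · refine le_antisymm (le_inf (Submodule.span_mono Set.subset_union_left) hle) ?_
    rintro x ⟨hx, hx0⟩
    rw [SetLike.mem_coe, Submodule.span_union, Submodule.mem_sup] at hx
    obtain ⟨y, hy, z, hz, rfl⟩ := hx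
    obtain ⟨c, rfl⟩ := Submodule.mem_span_singleton.1 hz
    have hy0 : ℓ y = 0 := hle hy
    rw [SetLike.mem_coe, LinearMap.mem_ker, map_add, map_smul, hy0, hP, zero_add, smul_eq_mul,
      mul_one] at hx0
    rwa [hx0, zero_smul, add_zero]

end Elimination

/-- The linear form `F ↦ ∑ s, c s * F (z s)`. -/
def linForm {ι X : Type} [Fintype ι] (c : ι → ZMod 2) (z : ι → X) :
    (X → ZMod 2) →ₗ[ZMod 2] ZMod 2 :=
  ∑ s, c s • LinearMap.proj (z s)

theorem linForm_apply {ι X : Type} [Fintype ι] (c : ι → ZMod 2) (z : ι → X) (F : X → ZMod 2) :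
    linForm c z F = ∑ s, c s * F (z s) := by
  simp [linForm]

namespace MultiStructure

variable {K : MultiStructure} {E : (R : K.Symb) → List (Fin (K.arity R) → ZMod 2)} {n : ℕ}
  {τ : Fin n → K.Srt}

/-- The common kernel of the equations attached to a list of constraints. -/
def eqnModule (E : (R : K.Symb) → List (Fin (K.arity R) → ZMod 2))
    (C : List (K.Constraint τ)) : Submodule (ZMod 2) (Fin n → ZMod 2) :=
  ⨅ c ∈ C, ⨅ e ∈ E c.symb, LinearMap.ker (linForm e c.scope)

theorem mem_eqnModule {C : List (K.Constraint τ)} {F : Fin n → ZMod 2} :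
    F ∈ eqnModule E C ↔ ∀ c ∈ C, ∀ e ∈ E c.symb, ∑ s, e s * F (c.scope s) = 0 := by
  simp only [eqnModule, Submodule.mem_iInf, LinearMap.mem_ker, linForm_apply]

theorem eqnModule_nil : eqnModule E ([] : List (K.Constraint τ)) = ⊤ := by
  simp [eqnModule]

theorem eqnModule_append_singleton (C : List (K.Constraint τ)) (c : K.Constraint τ) :
    eqnModule E (C ++ [c]) =
      eqnModule E C ⊓ ⨅ e ∈ E c.symb, LinearMap.ker (linForm e c.scope) := by
  ext F
  simp [eqnModule, or_imp, forall_and]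

end MultiStructure

/-! ### Solution counts over `H` and over `H.splitAt f a` agree modulo 2. -/

namespace RelStructure

open MultiStructure

variable {H : RelStructure} {f : H.carrier → H.carrier → H.carrier} {a : H.carrier}

theorem coe_cast_splitAt {i j : Fin 2} (h : i = j) (x : (H.splitAt f a).Dom i) :
    (cast (congrArg (H.splitAt f a).Dom h) x).1 = x.1 := by
  subst h
  rfl

/-- The elements of the domain of a sort of `H.splitAt f a`. -/
def InDom (H : RelStructure) (f : H.carrier → H.carrier → H.carrier) (a : H.carrier) (i : Fin 2)
    (x : H.carrier) : Prop :=
  if i = 0 then x ≠ a else f a x = x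

/-- Forgetting the subtypes turns a sorted solution into an ordinary function to `H.carrier` with
membership conditions, which disposes of the casts between domains. -/
theorem numSolutions_splitAt (J : (H.splitAt f a).Instance) :
    J.numSolutions = Nat.card {φ : Fin J.n → H.carrier |
      (∀ c ∈ J.constraints, (fun s => φ (c.scope s)) ∈ H.rel c.symb.1) ∧
        ∀ v, InDom H f a (J.τ v) (φ v)} := by
  have key : ∀ (φ : (v : Fin J.n) → (H.splitAt f a).Dom (J.τ v))
      (c : (H.splitAt f a).Constraint J.τ),
      ((fun s => cast (congrArg (H.splitAt f a).Dom (c.sort_scope s)) (φ (c.scope s))) ∈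
        (H.splitAt f a).rel c.symb) ↔ (fun s => (φ (c.scope s)).1) ∈ H.rel c.symb.1 := by
    intro φ c
    have h : (fun s => (cast (congrArg (H.splitAt f a).Dom (c.sort_scope s)) (φ (c.scope s))).1) =
        fun s => (φ (c.scope s)).1 := funext fun s => coe_cast_splitAt (c.sort_scope s) _
    rw [← h]
    rfl
  have hdom : ∀ i x, InDom H f a i x ↔ if i = 0 then x ≠ a else f a x = x := by
    intro i x
    rfl
  refine Nat.card_congr
    ⟨fun φ => ⟨fun v => (φ.1 v).1, fun c hc => (key _ c).1 (φ.2 c hc), fun v => ?_⟩,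
      fun φ => ⟨fun v => ⟨φ.1 v, ?_⟩, fun c hc =>
        (key (fun v => ⟨φ.1 v, _⟩) c).2 (φ.2.1 c hc)⟩,
      fun φ => rfl, fun φ => rfl⟩
  · have := (φ.1 v).2
    simp only [InDom]
    convert this
  · have := φ.2.2 v
    simp only [InDom] at this
    convert this

/-- The instance over `H.splitAt f a` with the same variables and the same constraints and with
given sorts. -/
def splitInstance (f : H.carrier → H.carrier → H.carrier) (a : H.carrier) (I : H.toMulti.Instance)
    (σ : Fin I.n → Fin 2) : (H.splitAt f a).Instance where
  n := I.n
  τ := σ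
  constraints := I.constraints.map fun c => ⟨⟨c.symb, fun s => σ (c.scope s)⟩, c.scope, fun _ => rfl⟩

/-- The number of solutions modulo `2` is that of solutions over the sorts given by the supports of
generators of the space of flips. -/
theorem numSolutions_mod_two_eq (hfix : ∀ x, f a x = x ↔ x = a) (hinv : Function.Involutive (f a))
    (hid : ∀ x, x ≠ a → ∀ y, f x y = y) (hf : H.IsBinaryPolymorphism f)
    {E : (R : H.Symb) → List (Fin (H.arity R) → ZMod 2)}
    (hE : ∀ R F, F ∈ flipModule (f a) hinv (H.rel R) ↔ ∀ c ∈ E R, ∑ i, c i * F i = 0)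
    (I : H.toMulti.Instance) (M : Fin I.n → Fin I.n → ZMod 2)
    (hM : Submodule.span (ZMod 2) (Set.range M) = eqnModule E I.constraints)
    (σ : Fin I.n → Fin 2) (hσ : ∀ v, σ v = 0 ↔ ∀ k, M k v = 0) :
    I.numSolutions % 2 = (splitInstance f a I σ).numSolutions % 2 := by
  classical
  let S : Set (Fin I.n → H.carrier) := {φ | I.IsSolution φ}
  have hS : ∀ φ, φ ∈ S ↔ ∀ c ∈ I.constraints, (fun s => φ (c.scope s)) ∈ H.rel c.symb :=
    fun φ => Iff.rfl
  have hrow : ∀ F ∈ List.ofFn M, ∀ φ ∈ S, flip₂ (f a) F φ ∈ S := by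
    intro F hF φ hφ c hc
    obtain ⟨k, rfl⟩ := (List.mem_ofFn' _ _).1 hF
    have hmem : M k ∈ eqnModule E I.constraints := hM ▸ Submodule.subset_span ⟨k, rfl⟩
    exact (hE c.symb _).2 (mem_eqnModule.1 hmem c hc) _ (hφ c hc)
  have hsupp : ∀ φ ∈ S, ∀ v, φ v = a → σ v ≠ 0 := by
    intro φ hφ v hv hσv
    -- Acting on `ψ` by f(φ, ·) is the flip by the indicator of φ⁻¹(a), and the polymorphism `f`
    -- preserves the relation; so the indicator satisfies all equations.
    have hmem : (fun v => if φ v = a then (1 : ZMod 2) else 0) ∈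
        Submodule.span (ZMod 2) (Set.range M) := by
      rw [hM]
      refine mem_eqnModule.2 fun c hc => (hE c.symb _).1 fun ψ hψ => ?_
      convert hf c.symb _ (hφ c hc) ψ hψ using 1
      funext s
      change flip₂ (f a) (fun s => if φ (c.scope s) = a then (1 : ZMod 2) else 0) ψ s =
        f (φ (c.scope s)) (ψ s)
      by_cases h : φ (c.scope s) = a
      · simp [flip₂, h]
      · simp [flip₂, h, hid _ h]
    -- The coordinate `v` vanishes on all generators, hence on the indicator just found, whose value
    -- at `v` is 1.
    have hle : Submodule.span (ZMod 2) (Set.range M) ≤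
        LinearMap.ker (LinearMap.proj (R := ZMod 2) (φ := fun _ : Fin I.n => ZMod 2) v) := by
      rw [Submodule.span_le]
      rintro _ ⟨k, rfl⟩
      exact (hσ v).1 hσv k
    have := hle hmem
    simp [hv] at this
  have h := card_modEq_card_fixed_list hinv S (List.ofFn M) hrow
  rw [numSolutions_splitAt]
  refine Eq.trans h (congrArg (· % 2) (Nat.card_congr (Equiv.setCongr ?_)))
  ext φ
  -- Being fixed by all row flips means having fixed points of `f a` as values on the union of the
  -- supports, and `a` is the only one.
  have hfx : (∀ F ∈ List.ofFn M, flip₂ (f a) F φ = φ) ↔ ∀ v, σ v ≠ 0 → φ v = a := by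
    simp only [List.mem_ofFn', Set.forall_mem_range, flip₂_eq_self_iff, hfix]
    constructor
    · intro h v hv
      rw [Ne, hσ, not_forall] at hv
      exact h hv.choose v hv.choose_spec
    · exact fun h k v hk => h v fun h0 => hk ((hσ v).1 h0 k)
  have hcon : φ ∈ S ↔ ∀ c ∈ (splitInstance f a I σ).constraints,
      (fun s => φ (c.scope s)) ∈ H.rel c.symb.1 := by
    rw [hS]
    refine ⟨fun h c hc => ?_, fun h c hc => h _ (List.mem_map_of_mem hc)⟩
    obtain ⟨d, hd, rfl⟩ := List.mem_map.1 hc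
    exact h d hd
  change (φ ∈ S ∧ _) ↔ (_ ∧ ∀ v, InDom H f a (σ v) (φ v))
  rw [hfx, hcon]
  refine and_congr_right fun hφ => ?_
  rw [← hcon] at hφ
  refine forall_congr' fun v => ?_
  by_cases hv : σ v = 0
  -- Off the supports the domain condition holds for every solution, so it may be added for free.
  · simp only [InDom, hv, if_pos, ne_eq, not_true_eq_false, false_implies, true_iff]
    exact fun h => hsupp φ hφ v h hv
  · simp only [InDom, hv, if_false, hfix, ne_eq, not_false_eq_true, true_implies]

end RelStructure

/-! ### Gaussian elimination over ℤ/2 as a program. -/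

namespace RAM

variable {O : List ℕ → ℕ}

/-- The input word `w` is still in place. -/
def InputAt (w : List ℕ) (s : Store) : Prop := (s 0 = fun i => w.getD i 0) ∧ s 1 0 = w.length

theorem InputAt.congr {w : List ℕ} {s s' : Store} (h : InputAt w s) (h0 : s' 0 = s 0)
    (h1 : s' 1 = s 1) : InputAt w s' := by
  rw [InputAt, h0, h1]
  exact h

/-- The stores agree except for the given arrays. -/
def AgreeOff (L : List ℕ) (s s' : Store) : Prop := ∀ A, A ∉ L → s' A = s A

theorem AgreeOff.refl (L : List ℕ) (s : Store) : AgreeOff L s s := fun _ _ => rfl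

theorem AgreeOff.trans {L L' L'' : List ℕ} {s s' s'' : Store} (h : AgreeOff L s s')
    (h' : AgreeOff L' s' s'') (hL : L ⊆ L'') (hL' : L' ⊆ L'') : AgreeOff L'' s s'' :=
  fun A hA => (h' A fun hm => hA (hL' hm)).trans (h A fun hm => hA (hL hm))

theorem agreeOff_write (s : Store) {L : List ℕ} {A : ℕ} (i n : ℕ) (hA : A ∈ L) :
    AgreeOff L s (s.write A i n) :=
  fun _ hA' => Store.write_of_ne _ _ _ fun h => hA' (h ▸ hA)

/-! ### Matrices over the field with two elements

The array `8` holds a square matrix of size `n`, row by row, and the array `7` holds the addresses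
of its rows; `n` is the first letter of the input. -/

/-- The store holds the matrix `M`. -/
def Mat (n : ℕ) (s : Store) (M : Fin n → Fin n → ZMod 2) : Prop :=
  s 0 0 = n ∧ (∀ k : Fin n, s 7 k = k * n) ∧ ∀ k j : Fin n, s 8 (k * n + j) = (M k j).val

theorem Mat.congr {n : ℕ} {s s' : Store} {M : Fin n → Fin n → ZMod 2} (h : Mat n s M)
    (h0 : s' 0 = s 0) (h7 : s' 7 = s 7) (h8 : s' 8 = s 8) : Mat n s' M := by
  rw [Mat, h0, h7, h8]
  exact h

/-- Quotient and remainder by `n` recover row and column, so writing one entry leaves all the others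
intact. -/
theorem address_inj {n : ℕ} {k k' j j' : Fin n} :
    (k : ℕ) * n + j = k' * n + j' ↔ k = k' ∧ j = j' := by
  constructor
  · intro h
    have hk : (k : ℕ) = k' := by
      have h' := congrArg (· / n) h
      have hn : 0 < n := k.pos
      simpa [Nat.add_comm _ (j : ℕ), Nat.add_comm _ (j' : ℕ), Nat.add_mul_div_right _ _ hn,
        Nat.div_eq_of_lt j.2, Nat.div_eq_of_lt j'.2] using h'
    refine ⟨Fin.ext hk, Fin.ext ?_⟩
    rw [hk] at h
    omega
  · rintro ⟨rfl, rfl⟩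
    rfl

/-- The matrix entry in row `i` and column `j`. -/
def entry (i j : Expr) : Expr := .get 8 (.add (.get 7 i) j)

theorem Mat.eval_entry {n : ℕ} {s : Store} {M : Fin n → Fin n → ZMod 2} (h : Mat n s M)
    {i j : Expr} (k l : Fin n) (hi : i.eval s = k) (hj : j.eval s = l) :
    (entry i j).eval s = (M k l).val := by
  simp only [entry, Expr.eval, hi, hj, h.2.1, h.2.2]

/-- On bits, the absolute difference is addition modulo 2. -/
theorem eval_neq_val {e e' : Expr} {s : Store} {u v : ZMod 2} (h : e.eval s = u.val)
    (h' : e'.eval s = v.val) : (neq e e').eval s = (u + v).val := by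
  simp only [neq, Expr.eval, h, h']
  have key : ∀ u v : ZMod 2, u.val - v.val + (v.val - u.val) = (u + v).val := by decide
  exact key u v

/-- The sum modulo `2` of a list of expressions with values `0` and `1`. -/
def xorAll : List Expr → Expr
  | [] => .const 0
  | e :: l => neq e (xorAll l)

theorem eval_xorAll {ι : Type*} {l : List ι} {e : ι → Expr} {u : ι → ZMod 2} {s : Store}
    (h : ∀ x ∈ l, (e x).eval s = (u x).val) :
    (xorAll (l.map e)).eval s = (l.map u).sum.val := by
  induction l with
  | nil => rfl
  | cons x l ih =>
    exact eval_neq_val (h x List.mem_cons_self) (ih fun y hy => h y (List.mem_cons_of_mem _ hy))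

/-- The first letter of the input. -/
abbrev sizeExpr : Expr := .get 0 (.const 0)

/-- Copy row `i` (the value of `5[0]`) of the matrix to array `9`. -/
def copyRow : Prog :=
  forLoop 6 sizeExpr (.assign 9 (scal 6) (entry (scal 5) (scal 6)))

theorem Run.copyRow {n : ℕ} {s : Store} {M : Fin n → Fin n → ZMod 2} (h : Mat n s M) {i : Fin n}
    (hi : s 5 0 = i) {Q : Store → Prop}
    (hQ : ∀ s', AgreeOff [6, 9] s s' → (∀ j : Fin n, s' 9 j = (M i j).val) → Q s') :
    Run O copyRow s (n * 3 + 2) Q := by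
  refine (Run.forLoop (N := n) (Tb := 1)
    (fun j s' => AgreeOff [6, 9] s s' ∧ ∀ k : Fin n, (k : ℕ) < j → s' 9 k = (M i k).val)
    ?_ ?_ ?_ ?_).mono le_rfl fun _ => id
  · rintro j s' ⟨hs', -⟩
    simp only [Expr.eval]
    rw [hs' 0 (by decide)]
    exact h.1
  · rintro j s' hj ⟨hs', hrow⟩ hc
    have hM : Mat n s' M :=
      h.congr (hs' 0 (by decide)) (hs' 7 (by decide)) (hs' 8 (by decide))
    have he : (entry (scal 5) (scal 6)).eval s' = (M i ⟨j, hj⟩).val :=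
      hM.eval_entry i ⟨j, hj⟩ (by simp only [Expr.eval]; rw [hs' 5 (by decide)]; exact hi)
        (by simp only [Expr.eval]; exact hc)
    refine Run.assign ⟨?_, ?_, fun k hk => ?_⟩
    · rw [Store.write_of_ne _ _ _ (by decide), hc]
    · exact (hs'.trans (agreeOff_write _ _ _ (by decide)) (fun _ => id) (fun _ => id)).trans
        (agreeOff_write _ _ _ (by decide)) (fun _ => id) (fun _ => id)
    · rw [Store.write_of_ne _ _ _ (by decide), Store.write_self, he]
      simp only [Expr.eval, hc]
      rcases Nat.lt_succ_iff_lt_or_eq.1 hk with hk | rfl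
      · rw [Function.update_of_ne hk.ne, hrow k hk]
      · rw [Function.update_self]
  · exact ⟨agreeOff_write _ _ _ (by decide), fun k hk => absurd hk (Nat.not_lt_zero _)⟩
  · rintro s' ⟨hs', hrow⟩
    exact hQ s' hs' fun j => hrow j j.2

/-- Add array `9` to row `i` (the value of `5[0]`) of the matrix. -/
def addRow : Prog :=
  forLoop 6 sizeExpr (.assign 8 (.add (.get 7 (scal 5)) (scal 6))
    (neq (entry (scal 5) (scal 6)) (.get 9 (scal 6))))

theorem Run.addRow {n : ℕ} {s : Store} {M : Fin n → Fin n → ZMod 2} (h : Mat n s M) {i : Fin n}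
    (hi : s 5 0 = i) {P : Fin n → ZMod 2} (hP : ∀ j : Fin n, s 9 j = (P j).val)
    {Q : Store → Prop}
    (hQ : ∀ s', AgreeOff [6, 8] s s' → Mat n s' (Function.update M i (M i + P)) → Q s') :
    Run O addRow s (n * 3 + 2) Q := by
  classical
  refine (Run.forLoop (N := n) (Tb := 1)
    (fun j s' => AgreeOff [6, 8] s s' ∧
      Mat n s' fun k l => if k = i ∧ (l : ℕ) < j then M k l + P l else M k l)
    ?_ ?_ ?_ ?_).mono le_rfl fun _ => id
  · rintro j s' ⟨hs', -⟩
    simp only [Expr.eval]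
    rw [hs' 0 (by decide)]
    exact h.1
  · rintro j s' hj ⟨hs', hM⟩ hc
    have h5 : (scal 5).eval s' = i := by
      simp only [Expr.eval]
      rw [hs' 5 (by decide)]
      exact hi
    have h6 : (scal 6).eval s' = j := by
      simp only [Expr.eval]
      exact hc
    have he : (neq (entry (scal 5) (scal 6)) (.get 9 (scal 6))).eval s' =
        (M i ⟨j, hj⟩ + P ⟨j, hj⟩).val := by
      refine eval_neq_val ((hM.eval_entry i ⟨j, hj⟩ h5 h6).trans (by simp)) ?_
      rw [Expr.eval, h6, hs' 9 (by decide)]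
      exact hP ⟨j, hj⟩
    have ha : (Expr.add (.get 7 (scal 5)) (scal 6)).eval s' = i * n + j := by
      rw [Expr.eval, Expr.eval, h5, h6, hM.2.1]
    refine Run.assign ⟨?_, ?_, ?_, fun k => ?_, fun k l => ?_⟩
    · rw [Store.write_of_ne _ _ _ (by decide), hc]
    · exact (hs'.trans (agreeOff_write _ _ _ (by decide)) (fun _ => id) (fun _ => id)).trans
        (agreeOff_write _ _ _ (by decide)) (fun _ => id) (fun _ => id)
    · rw [Store.write_of_ne _ _ _ (by decide), Store.write_of_ne _ _ _ (by decide)]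
      exact hM.1
    · rw [Store.write_of_ne _ _ _ (by decide), Store.write_of_ne _ _ _ (by decide)]
      exact hM.2.1 k
    · rw [Store.write_of_ne _ _ _ (by decide), Store.write_self, he, ha]
      by_cases hkl : k = i ∧ l = ⟨j, hj⟩
      · obtain ⟨rfl, rfl⟩ := hkl
        simp
      · rw [Function.update_of_ne, hM.2.2]
        · congr 1
          refine if_congr (and_congr_right fun hk => ?_) rfl rfl
          have : (l : ℕ) ≠ j := fun h => hkl ⟨hk, Fin.ext h⟩
          omega
        · exact fun h => hkl (address_inj (j' := ⟨j, hj⟩).1 h)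
  · refine ⟨agreeOff_write _ _ _ (by decide), ?_⟩
    simp only [Nat.not_lt_zero, and_false, if_false]
    exact h.congr (Store.write_of_ne _ _ _ (by decide)) (Store.write_of_ne _ _ _ (by decide))
      (Store.write_of_ne _ _ _ (by decide))
  · rintro s' ⟨hs', hM⟩
    refine hQ s' hs' ?_
    convert hM using 1
    funext k l
    by_cases hk : k = i
    · subst hk
      simp
    · simp [hk]

/-- Replace the rows of the matrix by generators of the subspace of their span that is given by a
linear equation; the expression `test` has the value of the linear form at the row `5[0]`. -/
def eliminate (test : Expr) : Prog :=
  .seq (.assign 10 (.const 0) (.const 0))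
    (forLoop 5 sizeExpr
      (.ite test
        (.seq (.ite (scal 10) .skip (.seq copyRow (.assign 10 (.const 0) (.const 1)))) addRow)
        .skip))

/-- The test must be correct for every matrix `M'` that can arise during the elimination, not only
for the initial one, since rows are overwritten on the way. -/
theorem Run.eliminate {n : ℕ} {s : Store} {M : Fin n → Fin n → ZMod 2} (h : Mat n s M)
    (ℓ : (Fin n → ZMod 2) →ₗ[ZMod 2] ZMod 2) {test : Expr}
    (htest : ∀ s' M' (i : Fin n), AgreeOff [5, 6, 8, 9, 10] s s' → Mat n s' M' → s' 5 0 = i →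
      test.eval s' = (ℓ (M' i)).val) {Q : Store → Prop}
    (hQ : ∀ s' M', AgreeOff [5, 6, 8, 9, 10] s s' → Mat n s' M' →
      Submodule.span (ZMod 2) (Set.range M') =
        Submodule.span (ZMod 2) (Set.range M) ⊓ LinearMap.ker ℓ → Q s') :
    Run O (eliminate test) s (n * (6 * n + 20) + 20) Q := by
  refine (Run.seq (Run.assign (Run.forLoop (N := n)
    (Tb := n * 3 + 2 + 1 + 1 + (n * 3 + 2) + 1)
    -- Array 9 is tied to `P` only once the flag `10[0]` is 1; before that `P` is arbitrary.
    (fun i s' => ∃ M' P, AgreeOff [5, 6, 8, 9, 10] s s' ∧ Mat n s' M' ∧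
      (∀ j : Fin n, s' 10 0 = 1 → s' 9 j = (P j).val) ∧
      ElimInv (Submodule.span (ZMod 2) (Set.range M)) ℓ i M' P (s' 10 0))
    (Q := Q) ?_ ?_ ?_ ?_))).mono ?_ fun _ => id
  · rintro i s' ⟨M', P, -, hM, -⟩
    simp only [Expr.eval]
    exact hM.1
  · rintro i s' hi ⟨M', P, hs', hM, hP, hinv⟩ hc
    have ht := htest s' M' ⟨i, hi⟩ hs' hM hc
    have h2 : ∀ u : ZMod 2, u.val ≠ 0 → u = 1 := by decide
    have h2' : ∀ u : ZMod 2, u.val = 0 → u = 0 := by decide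
    have hfl : ∀ fl, fl ≠ 0 →
        ElimInv (Submodule.span (ZMod 2) (Set.range M)) ℓ i M' P fl → fl = 1 := by
      rintro fl h0 ⟨-, ⟨h1, -⟩ | ⟨h1, -⟩⟩
      · exact absurd h1 h0
      · exact h1
    refine Run.ite (fun he => ?_) (fun he => ?_)
    · rw [ht] at he
      have hℓ := h2 _ he
      -- The common end of both cases: a pivot is in array 9, whether old or just copied, and is
      -- added to row `i`.
      have hadd : ∀ s'' (P' : Fin n → ZMod 2), AgreeOff [6, 9, 10] s' s'' →
          (∀ j : Fin n, s'' 9 j = (P' j).val) → s'' 10 0 = 1 →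
          ElimInv (Submodule.span (ZMod 2) (Set.range M)) ℓ i M' P' 1 →
          Run O RAM.addRow s'' (n * 3 + 2) fun s' => s' 5 0 = i ∧
            ∃ M' P, AgreeOff [5, 6, 8, 9, 10] s (s'.write 5 0 (i + 1)) ∧
              Mat n (s'.write 5 0 (i + 1)) M' ∧
              (∀ j : Fin n, (s'.write 5 0 (i + 1)) 10 0 = 1 →
                (s'.write 5 0 (i + 1)) 9 j = (P j).val) ∧
              ElimInv (Submodule.span (ZMod 2) (Set.range M)) ℓ (i + 1) M' P
                ((s'.write 5 0 (i + 1)) 10 0) := by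
        intro s'' P' h₁ h₂ h₃ h₄
        have hM'' : Mat n s'' M' :=
          hM.congr (h₁ 0 (by decide)) (h₁ 7 (by decide)) (h₁ 8 (by decide))
        have hc'' : s'' 5 0 = i := by rw [h₁ 5 (by decide), hc]
        refine Run.addRow (i := ⟨i, hi⟩) hM'' hc'' h₂ fun s₃ h₅ h₆ => 
          ⟨?_, Function.update M' ⟨i, hi⟩ (M' ⟨i, hi⟩ + P'), P', ?_, ?_, ?_, ?_⟩
        · rw [h₅ 5 (by decide), hc'']
        · refine (hs'.trans (h₁.trans h₅ (L'' := [5, 6, 8, 9, 10]) (by decide) (by decide))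
            (fun _ => id) (fun _ => id)).trans (agreeOff_write _ _ _ (L := [5, 6, 8, 9, 10])
              (by decide)) (fun _ => id) (fun _ => id)
        · exact h₆.congr (Store.write_of_ne _ _ _ (by decide))
            (Store.write_of_ne _ _ _ (by decide)) (Store.write_of_ne _ _ _ (by decide))
        · intro j _
          rw [Store.write_of_ne _ _ _ (by decide), h₅ 9 (by decide), h₂]
        · rw [Store.write_of_ne _ _ _ (by decide), h₅ 10 (by decide), h₃]
          exact ElimInv.step (i := ⟨i, hi⟩) h₄ hℓ
      refine Run.seq ((Run.ite (T := n * 3 + 2 + 1) (fun hf => ?_) fun hf => ?_).mono le_rfl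
        fun _ => id)
      · have hf1 := hfl _ hf hinv
        simp only [Expr.eval] at hf1
        refine (Run.skip ?_).mono (by omega) fun _ => id
        refine hadd s' P (AgreeOff.refl _ _) (fun j => hP j hf1) hf1 ?_
        rwa [hf1] at hinv
      · simp only [Expr.eval] at hf
        rw [hf] at hinv
        -- The first row with value 1 becomes the pivot and is then added to itself, which clears
        -- it.
        refine Run.seq (Run.copyRow (i := ⟨i, hi⟩) hM hc fun s'' h₁ h₂ => Run.assign ?_)
        refine hadd _ (M' ⟨i, hi⟩) ?_ ?_ ?_ (ElimInv.pivot (i := ⟨i, hi⟩) hinv hℓ)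
        · exact h₁.trans (agreeOff_write _ _ _ (L := [10]) (by decide)) (by decide) (by decide)
        · intro j
          rw [Store.write_of_ne _ _ _ (by decide), h₂]
        · simp [Store.write, Expr.eval]
    · rw [ht] at he
      refine (Run.skip ⟨hc, M', P, ?_, ?_, ?_, ?_⟩).mono (by omega) fun _ => id
      · exact hs'.trans (agreeOff_write _ _ _ (L := [5, 6, 8, 9, 10]) (by decide))
          (fun _ => id) (fun _ => id)
      · exact hM.congr (Store.write_of_ne _ _ _ (by decide))
            (Store.write_of_ne _ _ _ (by decide)) (Store.write_of_ne _ _ _ (by decide))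
      · rw [Store.write_of_ne _ _ _ (by decide), Store.write_of_ne _ _ _ (by decide)]
        exact hP
      · rw [Store.write_of_ne _ _ _ (by decide)]
        exact ElimInv.step_of_eq_zero (i := ⟨i, hi⟩) hinv (h2' _ he)
  · refine ⟨M, 0, ?_, ?_, ?_, ?_⟩
    · exact (agreeOff_write _ _ _ (by decide)).trans (agreeOff_write _ _ _ (by decide))
        (fun _ => id) (fun _ => id)
    · refine h.congr ?_ ?_ ?_ <;>
        rw [Store.write_of_ne _ _ _ (by decide), Store.write_of_ne _ _ _ (by decide)]
    · intro j h1
      rw [Store.write_of_ne _ _ _ (by decide)] at h1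
      simp [Store.write, Expr.eval] at h1
    · rw [Store.write_of_ne _ _ _ (by decide)]
      simp only [Store.write, Expr.eval, and_self, if_true]
      exact ElimInv.zero rfl
  · rintro s' ⟨M', P, hs', hM, -, hinv⟩
    exact hQ s' M' hs' hM hinv.span_eq
  · have : n * (n * 3 + 2 + 1 + 1 + (n * 3 + 2) + 1 + 2) ≤ n * (6 * n + 20) :=
      Nat.mul_le_mul le_rfl (by omega)
    omega

end RAM

/-! ### The layout of the word of an instance. -/

namespace MultiStructure

variable {K : MultiStructure} (I : K.Instance)

/-- The position in the word of an instance after the given constraints. -/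
noncomputable def Instance.pos (d : List (K.Constraint I.τ)) : ℕ :=
  1 + I.n + (d.flatMap Constraint.encode).length

theorem Constraint.length_encode {n : ℕ} {τ : Fin n → K.Srt} (c : K.Constraint τ) :
    c.encode.length = K.arity c.symb + 1 := by
  simp [Constraint.encode]

theorem Instance.pos_append (d : List (K.Constraint I.τ)) (c : K.Constraint I.τ) :
    I.pos (d ++ [c]) = I.pos d + (K.arity c.symb + 1) := by
  simp [Instance.pos, Constraint.length_encode, add_assoc]

theorem Instance.length_encode : I.encode.length = I.pos I.constraints := by
  simp only [Instance.encode, Instance.pos, List.length_cons, List.length_append, List.length_ofFn]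
  ring

theorem Instance.n_le_length : I.n ≤ I.encode.length := by
  rw [I.length_encode, Instance.pos]
  omega

/-- Every constraint occupies at least one letter; this bounds the number of iterations of the
parser. -/
theorem Instance.length_constraints_le : I.constraints.length ≤ I.encode.length := by
  have h : ∀ d : List (K.Constraint I.τ), d.length ≤ I.pos d := by
    intro d
    induction d using List.reverseRecOn with
    | nil => exact Nat.zero_le _
    | append_singleton d c ih =>
      rw [I.pos_append, List.length_append, List.length_singleton]
      omega
  rw [I.length_encode]
  exact h _

theorem Instance.getD_encode_sort (v : Fin I.n) :
    I.encode.getD (1 + v) 0 = (Fintype.equivFin K.Srt (I.τ v) : ℕ) := by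
  rw [add_comm, Instance.encode, List.getD_cons_succ, List.getD_append _ _ _ _ (by simp)]
  simp [List.getD_eq_getElem?_getD]

variable {I}

theorem Instance.getD_encode_pos {d rest : List (K.Constraint I.τ)} {c : K.Constraint I.τ}
    (h : I.constraints = d ++ c :: rest) (k : ℕ) (hk : k < K.arity c.symb + 1) :
    I.encode.getD (I.pos d + k) 0 = c.encode.getD k 0 := by
  have he : I.encode = (I.n :: (List.ofFn (fun v => (Fintype.equivFin K.Srt (I.τ v) : ℕ)) ++
      d.flatMap Constraint.encode)) ++ (c.encode ++ rest.flatMap Constraint.encode) := by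
    simp [Instance.encode, h]
  have hl : (I.n :: (List.ofFn (fun v => (Fintype.equivFin K.Srt (I.τ v) : ℕ)) ++
      d.flatMap Constraint.encode)).length = I.pos d := by
    simp only [Instance.pos, List.length_cons, List.length_append, List.length_ofFn]
    ring
  rw [he, List.getD_append_right _ _ _ _ (by omega), hl, Nat.add_sub_cancel_left,
    List.getD_append _ _ _ _ (by rwa [Constraint.length_encode])]

theorem Instance.getD_encode_symb {d rest : List (K.Constraint I.τ)} {c : K.Constraint I.τ}
    (h : I.constraints = d ++ c :: rest) :
    I.encode.getD (I.pos d) 0 = (Fintype.equivFin K.Symb c.symb : ℕ) :=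
  Instance.getD_encode_pos h 0 (Nat.succ_pos _)

theorem Instance.getD_encode_scope {d rest : List (K.Constraint I.τ)} {c : K.Constraint I.τ}
    (h : I.constraints = d ++ c :: rest) (s : Fin (K.arity c.symb)) :
    I.encode.getD (I.pos d + (1 + s)) 0 = c.scope s := by
  rw [Instance.getD_encode_pos h _ (by omega), Constraint.encode, add_comm 1, List.getD_cons_succ]
  simp [List.getD_eq_getElem?_getD]

theorem Instance.pos_lt {d rest : List (K.Constraint I.τ)} {c : K.Constraint I.τ}
    (h : I.constraints = d ++ c :: rest) : I.pos d < I.encode.length := by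
  rw [I.length_encode, h]
  simp only [Instance.pos, List.flatMap_append, List.flatMap_cons, List.length_append,
    Constraint.length_encode]
  omega

end MultiStructure

/-! ### Parsing the constraints of the input. -/

namespace RAM

open MultiStructure

variable {O : List ℕ → ℕ}

/-- Go through the constraints of the input; `4[0]` is the current position. A branch consists of a
test for the current constraint, the arity of its symbol, and what to do with it. -/
def parseLoop (B : List (Expr × ℕ × Prog)) : Prog :=
  .seq (.assign 4 (.const 0) (.add (.const 1) sizeExpr))
    (.loop (.sub (scal 1) (scal 4))
      (dispatch (B.map fun b =>
        (b.1, .seq b.2.2 (.assign 4 (.const 0) (.add (scal 4) (.const (b.2.1 + 1))))))))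

/-- `Inv d` describes the store once the prefix `d` of the constraints has been processed. It must
survive any write to `4[0]`, because the position is advanced after the branch has run. The arity
stored in the branch must be that of the current symbol, so that the position lands on the next
constraint; the loop stops when it reaches the end of the word. -/
theorem Run.parseLoop {K : MultiStructure} {I : K.Instance} {B : List (Expr × ℕ × Prog)} {Tb : ℕ}
    (Inv : List (K.Constraint I.τ) → Store → Prop) (hin : ∀ d s, Inv d s → InputAt I.encode s)
    (hex : ∀ d c rest, I.constraints = d ++ c :: rest → ∀ s, Inv d s → s 4 0 = I.pos d →
      ∃ b ∈ B, b.1.eval s = 0)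
    (hstep : ∀ d c rest, I.constraints = d ++ c :: rest → ∀ s, Inv d s → s 4 0 = I.pos d →
      ∀ b ∈ B, b.1.eval s = 0 → b.2.1 = K.arity c.symb ∧
        Run O b.2.2 s Tb fun s' => s' 4 0 = I.pos d ∧ ∀ m, Inv (d ++ [c]) (s'.write 4 0 m))
    {s : Store} (hs : ∀ m, Inv [] (s.write 4 0 m)) {Q : Store → Prop}
    (hQ : ∀ s', Inv I.constraints s' → Q s') :
    Run O (parseLoop B) s (I.encode.length * (Tb + 1 + B.length + 1) + 2) Q := by
  have hs0 : s 0 0 = I.n := by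
    have h := congrFun (hin _ _ (hs 0)).1 0
    rw [Store.write_of_ne _ _ _ (by decide)] at h
    exact h
  have hsplit : ∀ i (hi : i < I.constraints.length), I.constraints =
      I.constraints.take i ++ I.constraints[i] :: I.constraints.drop (i + 1) := by
    intro i hi
    rw [← List.drop_eq_getElem_cons hi, List.take_append_drop]
  have key : Run O (.loop (.sub (scal 1) (scal 4)) (RAM.dispatch (B.map fun b =>
        (b.1, Prog.seq b.2.2 (.assign 4 (.const 0) (.add (scal 4) (.const (b.2.1 + 1))))))))
      (s.write 4 0 (1 + I.n)) ((I.constraints.length - 0) * (Tb + 1 + B.length + 1) + 1)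
      (fun s' => Inv (I.constraints.take I.constraints.length) s' ∧
        s' 4 0 = I.pos (I.constraints.take I.constraints.length)) := by
    refine Run.loop (fun i s' => Inv (I.constraints.take i) s' ∧
      s' 4 0 = I.pos (I.constraints.take i)) ?_ ?_ ?_ (Nat.zero_le _) ⟨?_, ?_⟩
    · rintro i s' hi ⟨h₁, h₂⟩
      have := Instance.pos_lt (hsplit i hi)
      simp only [Expr.eval, h₂, (hin _ _ h₁).2]
      omega
    · rintro s' ⟨h₁, h₂⟩
      rw [List.take_length] at h₂
      simp only [Expr.eval, h₂, (hin _ _ h₁).2, I.length_encode, Nat.sub_self]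
    · rintro i s' hi ⟨h₁, h₂⟩
      refine (Run.dispatch (T := Tb + 1) ?_ ?_).mono (by rw [List.length_map]) fun _ => id
      · obtain ⟨b, hb, h0⟩ := hex _ _ _ (hsplit i hi) s' h₁ h₂
        exact ⟨_, List.mem_map_of_mem hb, h0⟩
      · intro b' hb' h0
        obtain ⟨b, hb, rfl⟩ := List.mem_map.1 hb'
        obtain ⟨h₃, h₄⟩ := hstep _ _ _ (hsplit i hi) s' h₁ h₂ b hb h0
        refine Run.seq (h₄.mono le_rfl ?_)
        rintro s'' ⟨h₅, h₆⟩
        have ht : I.constraints.take (i + 1) = I.constraints.take i ++ [I.constraints[i]] :=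
          (List.take_concat_get' _ _ hi).symm
        refine Run.assign ⟨?_, ?_⟩
        · rw [ht]
          exact h₆ _
        · rw [ht, Instance.pos_append]
          simp only [Expr.eval, h₅, h₃]
          simp [Store.write]
    · exact hs _
    · simp [Store.write, Instance.pos]
  rw [List.take_length] at key
  have hassign : (Expr.add (.const 1) sizeExpr).eval s = 1 + I.n := by simp [Expr.eval, hs0]
  refine (Run.seq (T' := (I.constraints.length - 0) * (Tb + 1 + B.length + 1) + 1)
    (Run.assign ?_)).mono ?_ fun _ => id
  · rw [hassign]
    exact key.mono le_rfl fun s' h => hQ s' h.1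
  · have := Nat.mul_le_mul_right (Tb + 1 + B.length + 1) I.length_constraints_le
    simp only [Nat.sub_zero]
    omega

/-- The letter of the input that is `k + 1` places after the current position. -/
def scopeExpr (k : ℕ) : Expr := .get 0 (.add (scal 4) (.const (1 + k)))

/-- The letter of the input at the current position. -/
def symbExpr : Expr := .get 0 (scal 4)

theorem eval_symbExpr {K : MultiStructure} {I : K.Instance} {d rest : List (K.Constraint I.τ)}
    {c : K.Constraint I.τ} (h : I.constraints = d ++ c :: rest) {s : Store}
    (hin : InputAt I.encode s) (hp : s 4 0 = I.pos d) :
    symbExpr.eval s = (Fintype.equivFin K.Symb c.symb : ℕ) := by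
  simp only [symbExpr, Expr.eval, hp, hin.1]
  exact Instance.getD_encode_symb h

theorem eval_scopeExpr {K : MultiStructure} {I : K.Instance} {d rest : List (K.Constraint I.τ)}
    {c : K.Constraint I.τ} (h : I.constraints = d ++ c :: rest) {s : Store}
    (hin : InputAt I.encode s) (hp : s 4 0 = I.pos d) (k : Fin (K.arity c.symb)) :
    (scopeExpr k).eval s = c.scope k := by
  simp only [scopeExpr, Expr.eval, hp, hin.1]
  exact Instance.getD_encode_scope h k

theorem InputAt.agreeOff {w : List ℕ} {L : List ℕ} {s s' : Store} (h : InputAt w s)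
    (hs : AgreeOff L s s') (h0 : 0 ∉ L := by decide) (h1 : 1 ∉ L := by decide) : InputAt w s' :=
  h.congr (hs 0 h0) (hs 1 h1)

/-- Append a constraint word to the output: a symbol and the scope of the current constraint. -/
def pushConstraint (code r : ℕ) : Prog :=
  pushAll (.const code :: (List.finRange r).map fun k : Fin r => scopeExpr k)

theorem Run.pushConstraint {K : MultiStructure} {I : K.Instance}
    {d rest : List (K.Constraint I.τ)} {c : K.Constraint I.τ} (h : I.constraints = d ++ c :: rest)
    {s : Store} (hin : InputAt I.encode s) (hp : s 4 0 = I.pos d) {l : List ℕ} (hl : Out s l)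
    {code : ℕ} {Q : Store → Prop}
    (hQ : ∀ s', AgreeOff [2, 3] s s' →
      Out s' (l ++ code :: List.ofFn fun k => (c.scope k : ℕ)) → Q s') :
    Run O (pushConstraint code (K.arity c.symb)) s ((K.arity c.symb + 1) * 2 + 1) Q := by
  refine (Run.pushAll hl (fun e he s' hs' => ?_) fun s' h₁ h₂ => hQ s' ?_ ?_).mono (by simp)
    fun _ => id
  · rcases List.mem_cons.1 he with rfl | he
    · rfl
    · obtain ⟨k, -, rfl⟩ := List.mem_map.1 he
      simp only [scopeExpr, Expr.eval]
      rw [hs' 0 (by decide) (by decide), hs' 4 (by decide) (by decide)]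
  · intro A hA
    simp only [List.mem_cons, List.not_mem_nil, or_false, not_or] at hA
    exact h₁ A hA.1 hA.2
  · convert h₂ using 2
    simp only [List.map_cons, Expr.eval, List.map_map, Function.comp_def,
      eval_scopeExpr h hin hp, List.ofFn_eq_map]

end RAM

/-! ### The flip space of an instance and the union of its supports. -/

namespace RAM

open MultiStructure

variable {O : List ℕ → ℕ}

/-- Fill in the addresses of the rows and the identity matrix. -/
def initMatrix : Prog :=
  forLoop 5 sizeExpr
    (.seq (.assign 8 (.add (.get 7 (scal 5)) (scal 5)) (.const 1))
      -- Row addresses are multiples of `n`, obtained by repeated addition because the machine does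
      -- not multiply. The last iteration writes the unused cell `7[n]`.
      (.assign 7 (.add (scal 5) (.const 1)) (.add (.get 7 (scal 5)) sizeExpr)))

theorem Run.initMatrix {n : ℕ} {s : Store} (hn : s 0 0 = n) (h7 : s 7 0 = 0) (h8 : ∀ x, s 8 x = 0)
    {Q : Store → Prop}
    (hQ : ∀ s', AgreeOff [5, 7, 8] s s' → Mat n s' (fun k => Pi.single k 1) → Q s') :
    Run O initMatrix s (n * 4 + 2) Q := by
  classical
  refine (Run.forLoop (N := n) (Tb := 1 + 1)
    -- The range k ≤ i includes the address of row `i` itself, which the body needs.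
    (fun i s' => AgreeOff [5, 7, 8] s s' ∧ (∀ k ≤ i, s' 7 k = k * n) ∧
      ∀ k j : Fin n, s' 8 (k * n + j) = if k = j ∧ (k : ℕ) < i then 1 else 0)
    ?_ ?_ ?_ ?_).mono le_rfl fun _ => id
  · rintro j s' ⟨hs', -⟩
    simp only [Expr.eval]
    rw [hs' 0 (by decide)]
    exact hn
  · rintro i s' hi ⟨hs', ha, hm⟩ hc
    have h0 : s' 0 0 = n := by rw [hs' 0 (by decide), hn]
    refine Run.seq (Run.assign (Run.assign ⟨?_, ?_, fun k hk => ?_, fun k j => ?_⟩))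
    · rw [Store.write_of_ne _ _ _ (by decide), Store.write_of_ne _ _ _ (by decide), hc]
    · intro A hA
      rw [Store.write_of_ne, Store.write_of_ne, Store.write_of_ne, hs' A hA] <;>
        · rintro rfl
          simp at hA
    · rw [Store.write_of_ne _ _ _ (by decide), Store.write_self,
        Store.write_of_ne _ _ _ (by decide)]
      simp only [Expr.eval]
      rw [Store.write_of_ne _ _ _ (by decide), Store.write_of_ne _ _ _ (by decide),
        Store.write_of_ne _ _ _ (by decide), hc, h0, ha i le_rfl]
      by_cases hk' : k = i + 1
      · rw [hk', Function.update_self]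
        ring
      · rw [Function.update_of_ne hk', ha k (by omega)]
    · rw [Store.write_of_ne _ _ _ (by decide), Store.write_of_ne _ _ _ (by decide),
        Store.write_self]
      simp only [Expr.eval, hc, ha i le_rfl]
      by_cases hkj : k = ⟨i, hi⟩ ∧ j = ⟨i, hi⟩
      · obtain ⟨rfl, rfl⟩ := hkj
        simp
      · rw [Function.update_of_ne, hm]
        · refine if_congr (and_congr_right fun hk => ?_) rfl rfl
          have : (k : ℕ) ≠ i := fun h => hkj ⟨Fin.ext h, hk ▸ Fin.ext h⟩
          omega
        · exact fun h => hkj (address_inj (k' := ⟨i, hi⟩) (j' := ⟨i, hi⟩).1 h)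
  · refine ⟨agreeOff_write _ _ _ (by decide), fun k hk => ?_, fun k j => ?_⟩
    · rw [Store.write_of_ne _ _ _ (by decide), Nat.le_zero.1 hk, h7, zero_mul]
    · rw [Store.write_of_ne _ _ _ (by decide), h8]
      simp
  · rintro s' ⟨hs', ha, hm⟩
    refine hQ s' hs' ⟨by rw [hs' 0 (by decide), hn], fun k => ha k k.2.le, fun k j => ?_⟩
    rw [hm]
    by_cases hkj : k = j
    · subst hkj
      beta_reduce
      rw [Pi.single_eq_same, if_pos ⟨rfl, k.2⟩]
      rfl
    · beta_reduce
      rw [Pi.single_eq_of_ne (Ne.symm hkj), if_neg fun h => hkj h.1]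
      rfl

/-- The value of the linear form with coefficients `e` in the scope of the current constraint at
the row `5[0]`. -/
def eqnExpr {r : ℕ} (e : Fin r → ZMod 2) : Expr :=
  xorAll ((List.finRange r).map fun k =>
    if e k = 0 then .const 0 else entry (scal 5) (scopeExpr k))

section Constraints

variable {K : MultiStructure} {I : K.Instance}

/-- The coefficients are bits built into the program, so each product is either dropped or is a
matrix entry. -/
theorem eval_eqnExpr {d rest : List (K.Constraint I.τ)}
    {c : K.Constraint I.τ} (h : I.constraints = d ++ c :: rest) {s : Store}
    (hin : InputAt I.encode s) (hp : s 4 0 = I.pos d) {M : Fin I.n → Fin I.n → ZMod 2}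
    (hM : Mat I.n s M) {i : Fin I.n} (hi : s 5 0 = i) (e : Fin (K.arity c.symb) → ZMod 2) :
    (eqnExpr e).eval s = (linForm e c.scope (M i)).val := by
  have h2 : ∀ u : ZMod 2, u ≠ 0 → u = 1 := by decide
  rw [eqnExpr, eval_xorAll (u := fun k => e k * M i (c.scope k)), linForm_apply, Fin.sum_univ_def]
  intro k _
  by_cases hk : e k = 0
  · simp [hk, Expr.eval]
  · rw [if_neg hk, hM.eval_entry i (c.scope k) (by simpa only [Expr.eval] using hi) (eval_scopeExpr h hin hp k), h2 _ hk, one_mul]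

/-- Process the equations of the current constraint. -/
def eliminateAll {r : ℕ} (L : List (Fin r → ZMod 2)) : Prog :=
  seqAll (L.map fun e => eliminate (eqnExpr e))

theorem Run.eliminateAll {d rest : List (K.Constraint I.τ)}
    {c : K.Constraint I.τ} (h : I.constraints = d ++ c :: rest) {s : Store}
    (hin : InputAt I.encode s) (hp : s 4 0 = I.pos d) {M : Fin I.n → Fin I.n → ZMod 2}
    (hM : Mat I.n s M) (L : List (Fin (K.arity c.symb) → ZMod 2)) {Q : Store → Prop}
    (hQ : ∀ s' M', AgreeOff [5, 6, 8, 9, 10] s s' → Mat I.n s' M' →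
      Submodule.span (ZMod 2) (Set.range M') = Submodule.span (ZMod 2) (Set.range M) ⊓
        ⨅ e ∈ L, LinearMap.ker (linForm e c.scope) → Q s') :
    Run O (eliminateAll L) s (L.length * (I.n * (6 * I.n + 20) + 20) + 1) Q := by
  refine (Run.seqAll (done := []) (F := fun e => RAM.eliminate (eqnExpr e)) (fun done s' =>
    ∃ M', AgreeOff [5, 6, 8, 9, 10] s s' ∧ Mat I.n s' M' ∧
      Submodule.span (ZMod 2) (Set.range M') = Submodule.span (ZMod 2) (Set.range M) ⊓
        ⨅ e ∈ done, LinearMap.ker (linForm e c.scope)) ⟨M, AgreeOff.refl _ _, hM, by simp⟩ ?_).mono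
    le_rfl ?_
  · rintro done e s' ⟨M₁, h₁, h₂, h₃⟩ -
    refine Run.eliminate h₂ (linForm e c.scope) (fun s₂ M₂ i h₄ h₅ h₆ => ?_)
      fun s₂ M₂ h₄ h₅ h₆ => ⟨M₂, h₁.trans h₄ (fun _ => id) fun _ => id, h₅, ?_⟩
    · refine eval_eqnExpr h ((hin.agreeOff h₁).agreeOff h₄) ?_ h₅ h₆ e
      rw [h₄ 4 (by decide), h₁ 4 (by decide), hp]
    · rw [h₆, h₃, inf_assoc]
      congr 1
      ext F
      simp [or_imp, forall_and]
  · rintro s' ⟨M', h₁, h₂, h₃⟩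
    exact hQ s' M' h₁ h₂ h₃

/-- Replace the identity matrix by generators of the space given by the equations of all the
constraints. -/
noncomputable def solveEquations (K : MultiStructure)
    (E : (R : K.Symb) → List (Fin (K.arity R) → ZMod 2)) : Prog :=
  parseLoop (Finset.univ.toList.map fun R : K.Symb =>
    (neq symbExpr (.const (Fintype.equivFin K.Symb R)), K.arity R, eliminateAll (E R)))

/-- After the prefix `d` the rows span `eqnModule E d`. For the empty prefix this is the whole
space, hence the assumption on `M`. -/
theorem Run.solveEquations {E : (R : K.Symb) → List (Fin (K.arity R) → ZMod 2)} {m : ℕ}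
    (hm : ∀ R, (E R).length ≤ m) {s : Store} (hin : InputAt I.encode s)
    {M : Fin I.n → Fin I.n → ZMod 2} (hM : Mat I.n s M)
    (htop : Submodule.span (ZMod 2) (Set.range M) = ⊤) {Q : Store → Prop}
    (hQ : ∀ s' M', AgreeOff [4, 5, 6, 8, 9, 10] s s' → Mat I.n s' M' →
      Submodule.span (ZMod 2) (Set.range M') = eqnModule E I.constraints → Q s') :
    Run O (solveEquations K E) s (I.encode.length *
      (m * (I.n * (6 * I.n + 20) + 20) + 1 + 1 + Fintype.card K.Symb + 1) + 2) Q := by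
  refine (Run.parseLoop (I := I) (Tb := m * (I.n * (6 * I.n + 20) + 20) + 1) (fun d s' =>
    ∃ M', AgreeOff [4, 5, 6, 8, 9, 10] s s' ∧ Mat I.n s' M' ∧
      Submodule.span (ZMod 2) (Set.range M') = eqnModule E d) ?_ ?_ ?_ ?_ ?_).mono ?_ fun _ => id
  · rintro d s' ⟨M', h₁, h₂, h₃⟩
    exact hin.agreeOff h₁
  · rintro d c rest h s' ⟨M', h₁, h₂, h₃⟩ hp
    refine ⟨_, List.mem_map_of_mem (Finset.mem_toList.2 (Finset.mem_univ c.symb)), ?_⟩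
    rw [eval_neq, eval_symbExpr h (hin.agreeOff h₁) hp]
    rfl
  · rintro d c rest h s' ⟨M', h₁, h₂, h₃⟩ hp b hb h0
    obtain ⟨R, -, rfl⟩ := List.mem_map.1 hb
    rw [eval_neq, eval_symbExpr h (hin.agreeOff h₁) hp] at h0
    obtain rfl : c.symb = R := (Fintype.equivFin K.Symb).injective (Fin.ext h0)
    refine ⟨rfl, (Run.eliminateAll h (hin.agreeOff h₁) hp h₂ _ fun s₂ M₂ h₄ h₅ h₆ =>
      ⟨?_, fun x => ⟨M₂, ?_, ?_, ?_⟩⟩).mono ?_ fun _ => id⟩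
    · exact Nat.mul_le_mul_right (I.n * (6 * I.n + 20) + 20) (hm c.symb) |> Nat.succ_le_succ
    · rw [h₄ 4 (by decide), hp]
    · exact (h₁.trans h₄ (fun _ => id) (by decide)).trans
        (agreeOff_write _ _ _ (L := [4, 5, 6, 8, 9, 10]) (by decide)) (fun _ => id) (fun _ => id)
    · exact h₅.congr (Store.write_of_ne _ _ _ (by decide)) (Store.write_of_ne _ _ _ (by decide))
        (Store.write_of_ne _ _ _ (by decide))
    · rw [h₆, h₃, eqnModule_append_singleton]
  · intro x
    refine ⟨M, agreeOff_write _ _ _ (by decide), ?_, by rw [htop, eqnModule_nil]⟩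
    exact hM.congr (Store.write_of_ne _ _ _ (by decide)) (Store.write_of_ne _ _ _ (by decide))
      (Store.write_of_ne _ _ _ (by decide))
  · rintro s' ⟨M', h₁, h₂, h₃⟩
    exact hQ s' M' h₁ h₂ h₃
  · rw [List.length_map, Finset.length_toList, Finset.card_univ]

end Constraints

/-- Write the union of the supports of the rows to array `11`. -/
def rowSupport : Prog :=
  forLoop 5 sizeExpr (forLoop 6 sizeExpr
    (.ite (entry (scal 5) (scal 6)) (.assign 11 (scal 6) (.const 1)) .skip))

theorem Run.rowSupport {n : ℕ} {s : Store} {M : Fin n → Fin n → ZMod 2} (hM : Mat n s M)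
    (h11 : ∀ x, s 11 x = 0) {Q : Store → Prop}
    (hQ : ∀ s' (σ : Fin n → Fin 2), AgreeOff [5, 6, 11] s s' → (∀ v, σ v = 0 ↔ ∀ k, M k v = 0) →
      (∀ v : Fin n, s' 11 v = σ v) → Q s') :
    Run O rowSupport s (n * (n * 4 + 2 + 2) + 2) Q := by
  classical
  have hv0 : ∀ u : ZMod 2, u.val = 0 ↔ u = 0 := by decide
  refine (Run.forLoop (N := n) (Tb := n * 4 + 2) (fun i s' => AgreeOff [5, 6, 11] s s' ∧
    ∀ v : Fin n, s' 11 v = if ∃ k : Fin n, (k : ℕ) < i ∧ M k v ≠ 0 then 1 else 0)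
    ?_ ?_ ?_ ?_).mono le_rfl fun _ => id
  · rintro j s' ⟨hs', -⟩
    simp only [Expr.eval]
    rw [hs' 0 (by decide)]
    exact hM.1
  · rintro i s' hi ⟨hs', hsup⟩ hc
    -- The rows before `i` have been scanned completely, row `i` up to column `j`.
    refine Run.forLoop (N := n) (Tb := 1 + 1) (fun j s₂ => AgreeOff [6, 11] s' s₂ ∧
      ∀ v : Fin n, s₂ 11 v = if ∃ k : Fin n, ((k : ℕ) < i ∨ k = ⟨i, hi⟩ ∧ (v : ℕ) < j) ∧ M k v ≠ 0
        then 1 else 0) ?_ ?_ ?_ ?_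
    · rintro j s₂ ⟨hs₂, -⟩
      simp only [Expr.eval]
      rw [hs₂ 0 (by decide), hs' 0 (by decide)]
      exact hM.1
    · rintro j s₂ hj ⟨hs₂, hsup₂⟩ hc₂
      have hs₂' : AgreeOff [5, 6, 11] s s₂ := hs'.trans hs₂ (fun _ => id) (by decide)
      have he : (entry (scal 5) (scal 6)).eval s₂ = (M ⟨i, hi⟩ ⟨j, hj⟩).val := by
        refine (hM.congr (hs₂' 0 (by decide)) (hs₂' 7 (by decide))
          (hs₂' 8 (by decide))).eval_entry ⟨i, hi⟩ ⟨j, hj⟩ ?_ hc₂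
        simp only [Expr.eval]
        rw [hs₂ 5 (by decide), hc]
      -- Passing from `j` to j + 1 changes nothing except in column `j`, and there only if the entry
      -- is nonzero.
      have hstep : ∀ v : Fin n, ¬ (v = ⟨j, hj⟩ ∧ M ⟨i, hi⟩ ⟨j, hj⟩ ≠ 0) →
          ((∃ k : Fin n, ((k : ℕ) < i ∨ k = ⟨i, hi⟩ ∧ (v : ℕ) < j) ∧ M k v ≠ 0) ↔
          ∃ k : Fin n, ((k : ℕ) < i ∨ k = ⟨i, hi⟩ ∧ (v : ℕ) < j + 1) ∧ M k v ≠ 0) := by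
        intro v hv
        refine exists_congr fun k => and_congr_left fun hk => or_congr_right
          (and_congr_right fun hki => ?_)
        subst hki
        have : (v : ℕ) ≠ j := by
          intro h
          obtain rfl : v = ⟨j, hj⟩ := Fin.ext h
          exact hv ⟨rfl, hk⟩
        omega
      refine Run.ite (fun h0 => ?_) (fun h0 => ?_) <;> rw [he] at h0
      · rw [Ne, hv0] at h0
        refine Run.assign ⟨?_, ?_, fun v => ?_⟩
        · rw [Store.write_of_ne _ _ _ (by decide), hc₂]
        · exact (hs₂.trans (agreeOff_write _ _ _ (by decide)) (fun _ => id) (fun _ => id)).trans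
            (agreeOff_write _ _ _ (by decide)) (fun _ => id) (fun _ => id)
        · rw [Store.write_of_ne _ _ _ (by decide), Store.write_self]
          simp only [Expr.eval, hc₂]
          by_cases hv : v = ⟨j, hj⟩
          · subst hv
            rw [Function.update_self, if_pos ⟨⟨i, hi⟩, .inr ⟨rfl, Nat.lt_succ_self _⟩, h0⟩]
          · rw [Function.update_of_ne fun h => hv (Fin.ext h), hsup₂]
            exact if_congr (hstep v fun h => hv h.1) rfl rfl
      · rw [hv0] at h0
        refine Run.skip ⟨hc₂, hs₂.trans (agreeOff_write _ _ _ (by decide)) (fun _ => id)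
          (fun _ => id), fun v => ?_⟩
        rw [Store.write_of_ne _ _ _ (by decide), hsup₂]
        exact if_congr (hstep v fun h => h.2 h0) rfl rfl
    · refine ⟨agreeOff_write _ _ _ (by decide), fun v => ?_⟩
      rw [Store.write_of_ne _ _ _ (by decide), hsup]
      simp
    · rintro s₂ ⟨hs₂, hsup₂⟩
      refine ⟨by rw [hs₂ 5 (by decide), hc], (hs'.trans hs₂ (fun _ => id) (by decide)).trans
        (agreeOff_write _ _ _ (L := [5, 6, 11]) (by decide)) (fun _ => id) (fun _ => id),
        fun v => ?_⟩
      rw [Store.write_of_ne _ _ _ (by decide), hsup₂]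
      refine if_congr (exists_congr fun k => and_congr_left fun _ => ?_) rfl rfl
      simp only [v.2, and_true, Fin.ext_iff]
      omega
  · refine ⟨agreeOff_write _ _ _ (by decide), fun v => ?_⟩
    rw [Store.write_of_ne _ _ _ (by decide), h11]
    simp
  · rintro s' ⟨hs', hsup⟩
    refine hQ s' (fun v => if ∃ k : Fin n, (k : ℕ) < n ∧ M k v ≠ 0 then 1 else 0) hs' (fun v => ?_)
      fun v => ?_
    · by_cases h : ∃ k : Fin n, (k : ℕ) < n ∧ M k v ≠ 0
      · simp only [h, if_true, one_ne_zero, false_iff, not_forall]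
        exact h.imp fun k hk => hk.2
      · simp only [h, if_false, true_iff]
        exact fun k => by_contra fun hk => h ⟨k, k.2, hk⟩
    · rw [hsup]
      split_ifs <;> rfl

end RAM

/-! ### Writing and submitting the query. -/

namespace RAM

open MultiStructure

variable {O : List ℕ → ℕ}

theorem Out.length_eq {s : Store} {l : List ℕ} (h : Out s l) : s 3 0 = l.length := by
  rw [← h]
  simp

theorem Out.congr {s s' : Store} {l : List ℕ} (h : Out s l) (h2 : s' 2 = s 2) (h3 : s' 3 = s 3) :
    Out s' l := by
  rw [Out, h2, h3]
  exact h

theorem AgreeOffOut.agreeOff {s s' : Store} (h : AgreeOffOut s s') : AgreeOff [2, 3] s s' := by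
  intro A hA
  simp only [List.mem_cons, List.not_mem_nil, or_false, not_or] at hA
  exact h A hA.1 hA.2

/-- Submit the output word to the oracle. -/
def submit : Prog := .query 2 (scal 3) 0 (.const 0)

theorem Run.submit {s : Store} {l : List ℕ} (h : Out s l) {Q : Store → Prop}
    (hQ : ∀ s' : Store, s' 0 0 = O l → Q s') : Run O submit s (l.length + 1) Q := by
  have he : (scal 3).eval s = l.length := by
    simp only [Expr.eval]
    exact h.length_eq
  rw [← he]
  refine Run.query (hQ _ ?_)
  simp only [Expr.eval]
  simp only [Store.write, and_self, if_true]
  exact congrArg O h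

/-- A loop whose iterations append words to the output. -/
theorem Run.outLoop {N Tb : ℕ} {bound : Expr} {body : Prog} {s : Store} {l : List ℕ}
    (hl : Out s l) (u : Fin N → List ℕ)
    (hbound : ∀ s', AgreeOff [2, 3, 5] s s' → bound.eval s' = N)
    (hbody : ∀ (i : Fin N) s' l', AgreeOff [2, 3, 5] s s' → s' 5 0 = i → Out s' l' →
      Run O body s' Tb fun s'' => AgreeOff [2, 3] s' s'' ∧ Out s'' (l' ++ u i))
    {Q : Store → Prop}
    (hQ : ∀ s', AgreeOff [2, 3, 5] s s' → Out s' (l ++ (List.finRange N).flatMap u) → Q s') :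
    Run O (RAM.forLoop 5 bound body) s (N * (Tb + 2) + 2) Q := by
  refine Run.forLoop (fun i s' => AgreeOff [2, 3, 5] s s' ∧
    Out s' (l ++ ((List.finRange N).take i).flatMap u)) ?_ ?_ ?_ ?_
  · rintro i s' ⟨h₁, -⟩
    exact hbound s' h₁
  · rintro i s' hi ⟨h₁, h₂⟩ hc
    refine (hbody ⟨i, hi⟩ s' _ h₁ hc h₂).mono le_rfl ?_
    rintro s'' ⟨h₃, h₄⟩
    refine ⟨by rw [h₃ 5 (by decide), hc], (h₁.trans h₃ (fun _ => id) (by decide)).trans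
      (agreeOff_write _ _ _ (L := [2, 3, 5]) (by decide)) (fun _ => id) (fun _ => id), ?_⟩
    refine Out.congr ?_ (Store.write_of_ne _ _ _ (by decide)) (Store.write_of_ne _ _ _ (by decide))
    have ht : (List.finRange N).take (i + 1) = (List.finRange N).take i ++ [⟨i, hi⟩] := by
      rw [← List.take_concat_get' _ _ (by simpa using hi)]
      simp
    rw [ht, List.flatMap_append, ← List.append_assoc]
    simpa using h₄
  · refine ⟨agreeOff_write _ _ _ (by decide), ?_⟩
    refine Out.congr ?_ (Store.write_of_ne _ _ _ (by decide)) (Store.write_of_ne _ _ _ (by decide))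
    simpa using hl
  · rintro s' ⟨h₁, h₂⟩
    refine hQ s' h₁ ?_
    rwa [List.take_of_length_le (by simp)] at h₂

/-- Translate the constraints of the input: a constraint is copied with another symbol. An entry of
the list consists of a test for the current constraint, the new symbol, and the arity. -/
def translateLoop (L : List (Expr × ℕ × ℕ)) : Prog :=
  parseLoop (L.map fun b => (b.1, b.2.2, pushConstraint b.2.1 b.2.2))

/-- `code` may depend on the whole constraint and not only on its symbol, since over `H.splitAt f a`
the new symbol also records the sorts of the scope. The scope itself is copied unchanged. -/
theorem Run.translateLoop {K : MultiStructure} {I : K.Instance} {L : List (Expr × ℕ × ℕ)} {m : ℕ}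
    (hm : ∀ R, K.arity R ≤ m) (code : K.Constraint I.τ → ℕ) {s : Store}
    (hin : InputAt I.encode s) {l : List ℕ} (hl : Out s l)
    (hex : ∀ d c rest, I.constraints = d ++ c :: rest → ∀ s', AgreeOff [2, 3, 4] s s' →
      s' 4 0 = I.pos d → ∃ b ∈ L, b.1.eval s' = 0)
    (hcode : ∀ d c rest, I.constraints = d ++ c :: rest → ∀ s', AgreeOff [2, 3, 4] s s' →
      s' 4 0 = I.pos d → ∀ b ∈ L, b.1.eval s' = 0 → b.2.1 = code c ∧ b.2.2 = K.arity c.symb)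
    {Q : Store → Prop}
    (hQ : ∀ s', Out s' (l ++ I.constraints.flatMap fun c =>
      code c :: List.ofFn fun k => (c.scope k : ℕ)) → Q s') :
    Run O (translateLoop L) s
      (I.encode.length * ((m + 1) * 2 + 1 + 1 + L.length + 1) + 2) Q := by
  refine (Run.parseLoop (I := I) (Tb := (m + 1) * 2 + 1) (fun d s' => AgreeOff [2, 3, 4] s s' ∧
    Out s' (l ++ d.flatMap fun c => code c :: List.ofFn fun k => (c.scope k : ℕ)))
    ?_ ?_ ?_ ?_ ?_).mono ?_ fun _ => id
  · rintro d s' ⟨h₁, -⟩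
    exact hin.agreeOff h₁
  · rintro d c rest h s' ⟨h₁, h₂⟩ hp
    obtain ⟨b, hb, h0⟩ := hex d c rest h s' h₁ hp
    exact ⟨_, List.mem_map_of_mem hb, h0⟩
  · rintro d c rest h s' ⟨h₁, h₂⟩ hp b' hb' h0
    obtain ⟨b, hb, rfl⟩ := List.mem_map.1 hb'
    obtain ⟨h₃, h₄⟩ := hcode d c rest h s' h₁ hp b hb h0
    refine ⟨h₄, ?_⟩
    simp only [h₃, h₄]
    refine (Run.pushConstraint h (hin.agreeOff h₁) hp h₂ fun s'' h₅ h₆ => ⟨?_, fun x => ⟨?_, ?_⟩⟩).mono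
      (by have := hm c.symb; omega) fun _ => id
    · rw [h₅ 4 (by decide), hp]
    · exact (h₁.trans h₅ (fun _ => id) (by decide)).trans
        (agreeOff_write _ _ _ (L := [2, 3, 4]) (by decide)) (fun _ => id) (fun _ => id)
    · refine Out.congr ?_ (Store.write_of_ne _ _ _ (by decide))
        (Store.write_of_ne _ _ _ (by decide))
      simpa using h₆
  · intro x
    refine ⟨agreeOff_write _ _ _ (by decide), ?_⟩
    refine Out.congr ?_ (Store.write_of_ne _ _ _ (by decide)) (Store.write_of_ne _ _ _ (by decide))
    simpa using hl
  · rintro s' ⟨-, h₂⟩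
    exact hQ s' h₂
  · rw [List.length_map]

theorem inputAt_initStore (w : List ℕ) : InputAt w (initStore w) := by
  constructor
  · funext i
    simp [initStore]
  · simp [initStore]

theorem initStore_of_ne (w : List ℕ) {A : ℕ} (h0 : A ≠ 0) (h1 : A ≠ 1) (i : ℕ) :
    initStore w A i = 0 := by
  simp [initStore, h0, h1]

end RAM

/-! ### The reduction from `H` to `H.splitAt f a`. -/

namespace RelStructure

open MultiStructure RAM

variable {H : RelStructure} {f : H.carrier → H.carrier → H.carrier} {a : H.carrier}

/-- The word of `splitInstance f a I σ`. -/
theorem encode_splitInstance (I : H.toMulti.Instance) (σ : Fin I.n → Fin 2) :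
    (splitInstance f a I σ).encode = I.n ::
      ((List.finRange I.n).flatMap
        (fun v => [(Fintype.equivFin (H.splitAt f a).Srt (σ v) : ℕ)]) ++
      I.constraints.flatMap fun c =>
        (Fintype.equivFin (H.splitAt f a).Symb ⟨c.symb, fun s => σ (c.scope s)⟩ : ℕ) ::
          List.ofFn fun k => (c.scope k : ℕ)) := by
  have h : ∀ g : Fin I.n → ℕ, List.ofFn g = (List.finRange I.n).flatMap fun v => [g v] := by
    intro g
    rw [List.ofFn_eq_map, List.map_eq_flatMap]
  have h' : ∀ (C : List (H.toMulti.Constraint I.τ)) {β : Type} (g : H.toMulti.Constraint I.τ → β)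
      (u : β → List ℕ), (C.map g).flatMap u = C.flatMap fun c => u (g c) :=
    fun C _ g u => List.flatMap_map ..
  refine congrArg₂ List.cons rfl (congrArg₂ HAppend.hAppend (h _) ?_)
  exact h' I.constraints _ _

theorem length_encode_splitInstance (I : H.toMulti.Instance) (σ : Fin I.n → Fin 2) :
    (splitInstance f a I σ).encode.length = I.encode.length := by
  rw [encode_splitInstance, Instance.encode]
  simp only [List.length_cons, List.length_append, List.length_flatMap, List.length_ofFn,
    Constraint.encode, List.length_nil, List.map_const', List.sum_replicate, List.length_finRange]
  simp

/-- The table of symbols for the translation of constraints, with the sorts of the variables in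
array `11`. -/
noncomputable def splitTable (H : RelStructure) (f : H.carrier → H.carrier → H.carrier)
    (a : H.carrier) : List (Expr × ℕ × ℕ) :=
  Finset.univ.toList.map fun R : (H.splitAt f a).Symb =>
    (sumExpr (neq symbExpr (.const (Fintype.equivFin H.toMulti.Symb R.1)) ::
      (List.finRange (H.arity R.1)).map fun k : Fin (H.arity R.1) =>
        neq (.get 11 (scopeExpr k)) (.const (R.2 k))),
      Fintype.equivFin (H.splitAt f a).Symb R, H.arity R.1)

/-- The reduction of the counting problem over `H` to that over `H.splitAt f a`. -/
noncomputable def splitProg (H : RelStructure) (f : H.carrier → H.carrier → H.carrier)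
    (a : H.carrier) (E : (R : H.Symb) → List (Fin (H.arity R) → ZMod 2)) : Prog :=
  .seq initMatrix (.seq (solveEquations H.toMulti E) (.seq rowSupport (.seq (push sizeExpr)
    (.seq (forLoop 5 sizeExpr (.ite (.get 11 (scal 5))
        (push (.const (Fintype.equivFin (H.splitAt f a).Srt (1 : Fin 2))))
        (push (.const (Fintype.equivFin (H.splitAt f a).Srt (0 : Fin 2))))))
      (.seq (translateLoop (splitTable H f a)) submit)))))

/-- The equations `E R` depend on `H` only and are built into the program, which computes the union
of supports in array 11, reads it as the sorts and asks one query. -/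
theorem polyTimeReducible_splitAt (hfix : ∀ x, f a x = x ↔ x = a)
    (hinv : Function.Involutive (f a)) (hid : ∀ x, x ≠ a → ∀ y, f x y = y)
    (hf : H.IsBinaryPolymorphism f) :
    PolyTimeReducible (H.toMulti.modCSP 2) ((H.splitAt f a).modCSP 2) := by
  choose E hE using fun R => Submodule.exists_equations (flipModule (f a) hinv (H.rel R))
  obtain ⟨m, hm⟩ : ∃ m, ∀ R, (E R).length ≤ m :=
    ⟨∑ R, (E R).length, fun R => Finset.single_le_sum (f := fun R => (E R).length)
      (fun _ _ => Nat.zero_le _) (Finset.mem_univ R)⟩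
  obtain ⟨r, hr⟩ : ∃ r, ∀ R, H.arity R ≤ r :=
    ⟨∑ R, H.arity R, fun R => Finset.single_le_sum (fun _ _ => Nat.zero_le _) (Finset.mem_univ R)⟩
  -- The left side is the sum of the time bounds of the phases, in the nesting produced by
  -- `Run.seq`; the polynomial is the same expression with `n` replaced by the word length.
  obtain ⟨T, hT⟩ : ∃ T : Polynomial ℕ, ∀ n L, n ≤ L →
      n * 4 + 2 + (L * (m * (n * (6 * n + 20) + 20) + 1 + 1 + Fintype.card H.toMulti.Symb + 1) + 2 +
        (n * (n * 4 + 2 + 2) + 2 + (2 + (n * (2 + 1 + 2) + 2 +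
          (L * ((r + 1) * 2 + 1 + 1 + (splitTable H f a).length + 1) + 2 + (L + 1)))))) ≤
      T.eval L := by
    refine ⟨.X * 4 + 2 + (.X * (.C m * (.X * (6 * .X + 20) + 20) + 1 + 1 +
      .C (Fintype.card H.toMulti.Symb) + 1) + 2 +
        (.X * (.X * 4 + 2 + 2) + 2 + (2 + (.X * (2 + 1 + 2) + 2 +
          (.X * ((.C r + 1) * 2 + 1 + 1 + .C (splitTable H f a).length + 1) + 2 + (.X + 1)))))),
      fun n L h => ?_⟩
    simp only [Polynomial.eval_add, Polynomial.eval_mul, Polynomial.eval_X, Polynomial.eval_C,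
      Polynomial.eval_ofNat, Polynomial.eval_one]
    gcongr
  refine ⟨splitProg H f a E, T, fun O hO I => ?_⟩
  change H.toMulti.Instance at I
  change ∃ s t, Exec O _ (initStore I.encode) s t ∧ t ≤ T.eval I.encode.length ∧
    s 0 0 = I.numSolutions % 2
  suffices h : Run O (splitProg H f a E) (initStore I.encode) (T.eval I.encode.length)
      fun s => s 0 0 = I.numSolutions % 2 from h
  have h0 := inputAt_initStore I.encode
  have hz : ∀ A, A ≠ 0 → A ≠ 1 → ∀ i, initStore I.encode A i = 0 :=
    fun A hA hA' i => initStore_of_ne _ hA hA' i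
  -- From here on it only matters that the input is in place and that all other arrays are zero.
  generalize initStore I.encode = s₀ at h0 hz ⊢
  have hn : s₀ 0 0 = I.n := congrFun h0.1 0
  refine Run.mono (Q := fun s => s 0 0 = I.numSolutions % 2) ?_ (hT I.n _ I.n_le_length)
    fun _ => id
  refine Run.seq (Run.initMatrix hn (hz 7 (by decide) (by decide) 0)
    (hz 8 (by decide) (by decide)) fun s₁ h₁ hM₁ => ?_)
  have htop : Submodule.span (ZMod 2) (Set.range fun k : Fin I.n =>
      (Pi.single k 1 : Fin I.n → ZMod 2)) = ⊤ := by
    have := (Pi.basisFun (ZMod 2) (Fin I.n)).span_eq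
    convert this with k
    simp
  refine Run.seq (Run.solveEquations (K := H.toMulti) hm (h0.agreeOff h₁) hM₁ htop
    fun s₂ M h₂ hM₂ hspan => ?_)
  have h02 := h₁.trans h₂ (L'' := [4, 5, 6, 7, 8, 9, 10]) (by decide) (by decide)
  refine Run.seq (Run.rowSupport hM₂ (fun x => ?_) fun s₃ σ h₃ hσ h11 => ?_)
  · rw [h02 11 (by decide)]
    exact hz 11 (by decide) (by decide) x
  have h03 := h02.trans h₃ (L'' := [4, 5, 6, 7, 8, 9, 10, 11]) (by decide) (by decide)
  have hin₃ := h0.agreeOff h03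
  have hout₃ : Out s₃ [] := by
    rw [Out, h03 3 (by decide), hz 3 (by decide) (by decide)]
    rfl
  refine Run.seq (Run.push hout₃ fun s₄ h₄ hout₄ => ?_)
  replace h₄ := h₄.agreeOff
  have hsize₃ : sizeExpr.eval s₃ = I.n := congrFun hin₃.1 0
  rw [hsize₃, List.nil_append] at hout₄
  have hin₄ := hin₃.agreeOff h₄
  have h11₄ : ∀ v : Fin I.n, s₄ 11 v = σ v := by
    rw [h₄ 11 (by decide)]
    exact h11
  refine Run.seq (Run.outLoop (N := I.n) (Tb := 2 + 1) hout₄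
    (fun v => [(Fintype.equivFin (H.splitAt f a).Srt (σ v) : ℕ)]) (fun s' hs' => ?_)
    (fun i s' l' hs' hi hl' => ?_) fun s₅ h₅ hout₅ => ?_)
  · exact congrFun (hin₄.agreeOff hs').1 0
  · have he : (Expr.get 11 (scal 5)).eval s' = σ i := by
      simp only [Expr.eval]
      rw [hi, hs' 11 (by decide), h11₄]
    refine Run.ite (fun h => Run.push hl' fun s'' h₆ h₇ => ⟨h₆.agreeOff, ?_⟩)
      fun h => Run.push hl' fun s'' h₆ h₇ => ⟨h₆.agreeOff, ?_⟩
    · rw [he] at h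
      have : σ i = 1 := by omega
      rw [this]
      exact h₇
    · rw [he] at h
      have : σ i = 0 := by omega
      rw [this]
      exact h₇
  have hin₅ := hin₄.agreeOff h₅
  have h11₅ : ∀ v : Fin I.n, s₅ 11 v = σ v := by
    rw [h₅ 11 (by decide)]
    exact h11₄
  -- A table entry matches exactly when its symbol is that of the constraint and its sort tuple
  -- agrees with array 11 along the scope.
  have htest : ∀ d c rest, I.constraints = d ++ c :: rest → ∀ s', AgreeOff [2, 3, 4] s₅ s' →
      s' 4 0 = I.pos d → ∀ R : (H.splitAt f a).Symb,
      (sumExpr (neq symbExpr (.const (Fintype.equivFin H.toMulti.Symb R.1)) ::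
        (List.finRange (H.arity R.1)).map fun k : Fin (H.arity R.1) =>
          neq (.get 11 (scopeExpr k)) (.const (R.2 k)))).eval s' = 0 ↔
      (⟨c.symb, fun s => σ (c.scope s)⟩ : (H.splitAt f a).Symb) = R := by
    rintro d c rest h s' hs' hp ⟨R, π⟩
    have hscope := eval_scopeExpr h (hin₅.agreeOff hs') hp
    simp only [eval_sumExpr_eq_zero, List.forall_mem_cons, eval_neq,
      eval_symbExpr h (hin₅.agreeOff hs') hp, List.forall_mem_map, List.mem_finRange, true_implies]
    simp only [Expr.eval]
    rw [hs' 11 (by decide)]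
    constructor
    · rintro ⟨h₆, h₇⟩
      obtain rfl : c.symb = R := (Fintype.equivFin H.toMulti.Symb).injective (Fin.ext h₆)
      refine Sigma.ext rfl (heq_of_eq (funext fun s => Fin.ext ?_))
      have := h₇ s
      rw [hscope s, h11₅] at this
      exact this
    · intro h₆
      obtain ⟨rfl, h₇⟩ := Sigma.mk.inj_iff.1 h₆
      refine ⟨rfl, fun s => ?_⟩
      rw [hscope s, h11₅, ← eq_of_heq h₇]
  refine Run.seq (Run.translateLoop (K := H.toMulti) hr
    (fun c => Fintype.equivFin (H.splitAt f a).Symb ⟨c.symb, fun s => σ (c.scope s)⟩) hin₅ hout₅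
    (fun d c rest h s' hs' hp => ?_) (fun d c rest h s' hs' hp b hb h0 => ?_) fun s₆ hout₆ => ?_)
  · exact ⟨_, List.mem_map_of_mem (Finset.mem_toList.2 (Finset.mem_univ _)),
      (htest d c rest h s' hs' hp _).2 rfl⟩
  · obtain ⟨R, -, rfl⟩ := List.mem_map.1 hb
    obtain rfl := (htest d c rest h s' hs' hp R).1 h0
    exact ⟨rfl, rfl⟩
  rw [List.singleton_append, List.cons_append, ← encode_splitInstance] at hout₆
  refine (Run.submit hout₆ fun s' hs' => ?_).mono (by rw [length_encode_splitInstance])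
    fun _ => id
  rw [hs', numSolutions_mod_two_eq hfix hinv hid hf hE I M hspan σ hσ]
  exact hO (splitInstance f a I σ)

end RelStructure

/-! ### Parity gadgets for the two domains. -/

namespace RelStructure

open MultiStructure

variable {H : RelStructure} {f : H.carrier → H.carrier → H.carrier} {a : H.carrier}

/-- A relational atom: a symbol and a tuple of variables. -/
abbrev RelAtom (H : RelStructure) (X : Type) := (R : H.Symb) × (Fin (H.arity R) → X)

/-- The assignments that satisfy a list of relational atoms. -/
def Sat {X : Type} (Γ : List (H.RelAtom X)) (v : X → H.carrier) : Prop :=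
  ∀ g ∈ Γ, (fun s => v (g.2 s)) ∈ H.rel g.1

/-- A choice of representatives for the equalities of a conjunction of atoms. -/
theorem exists_representatives {X : Type} (Φ : List (Atom H X)) (x₀ : X) :
    ∃ rep : X → X, rep x₀ = x₀ ∧ (∀ x, rep (rep x) = rep x) ∧
      (∀ y z, Atom.eq y z ∈ Φ → rep y = rep z) ∧
      ∀ v : X → H.carrier, (∀ A ∈ Φ, A.Holds v) → ∀ x, v (rep x) = v x := by
  classical
  let st : Setoid X := Relation.EqvGen.setoid fun y z => Atom.eq y z ∈ Φ
  have hout : ∀ x : X, st (Quotient.mk st x).out x := fun x => Quotient.mk_out x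
  -- The class of `x₀` is represented by `x₀` itself, so that the free variable keeps its value.
  let rep : X → X := fun x => if st x x₀ then x₀ else (Quotient.mk st x).out
  have hrep : ∀ x, st (rep x) x := by
    intro x
    by_cases h : st x x₀
    · simp only [rep, h, if_true]
      exact st.symm h
    · simp only [rep, h, if_false]
      exact hout x
  have hcongr : ∀ x y, st x y → rep x = rep y := by
    intro x y h
    have h1 : st x x₀ ↔ st y x₀ := ⟨fun h' => st.trans (st.symm h) h', fun h' => st.trans h h'⟩
    have h2 : Quotient.mk st x = Quotient.mk st y := Quotient.sound h
    simp only [rep, h1, h2]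
  refine ⟨rep, by simp [rep], fun x => hcongr _ _ (hrep x),
    fun y z h => hcongr _ _ (Relation.EqvGen.rel _ _ h), fun v hv x => ?_⟩
  have key : ∀ y z, Relation.EqvGen (fun y z => Atom.eq y z ∈ Φ) y z → v y = v z := by
    intro y z h
    induction h with
    | rel y z h => exact hv _ h
    | refl y => rfl
    | symm y z _ ih => exact ih.symm
    | trans x y z _ _ ih ih' => exact ih.trans ih'
  exact key _ _ (hrep x)

/-- Equalities can be removed from a conjunction of atoms without changing the numbers of
satisfying assignments. -/
theorem HasConstants.exists_sat_card_eq (hconst : H.HasConstants) {X : Type} [Finite X]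
    (Φ : List (Atom H X)) (x₀ : X) :
    ∃ Γ : List (H.RelAtom X), ∀ c, Nat.card {v : X → H.carrier // v x₀ = c ∧ Sat Γ v} =
      Nat.card {v : X → H.carrier // v x₀ = c ∧ ∀ A ∈ Φ, A.Holds v} := by
  classical
  have := Fintype.ofFinite X
  obtain ⟨rep, h0, hidem, heq, hv⟩ := exists_representatives Φ x₀
  rcases isEmpty_or_nonempty H.carrier with hE | ⟨⟨b⟩⟩
  · exact ⟨[], fun c => hE.elim c⟩
  obtain ⟨C, hC, hCrel⟩ := hconst b
  let toRel : Atom H X → Option (H.RelAtom X) := fun A => match A with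
    | .eq _ _ => none
    | .rel R z => some ⟨R, fun s => rep (z s)⟩
  -- Relational atoms are moved to the representatives. The other variables become superfluous and
  -- are pinned to the constant `b`, so that they contribute a factor 1 to the count.
  let Γ : List (H.RelAtom X) := Φ.filterMap toRel ++
    (Finset.univ.filter fun x => rep x ≠ x).toList.map fun x => ⟨C, fun _ => x⟩
  have hΓ : ∀ w : X → H.carrier, Sat Γ w ↔
      (∀ R z, Atom.rel R z ∈ Φ → (fun s => w (rep (z s))) ∈ H.rel R) ∧
        ∀ x, rep x ≠ x → w x = b := by
    intro w
    simp only [Sat, Γ, List.forall_mem_append, List.forall_mem_map, Finset.mem_toList,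
      Finset.mem_filter, Finset.mem_univ, true_and, hCrel]
    refine and_congr ⟨fun h R z hz => h ⟨R, fun s => rep (z s)⟩
      (List.mem_filterMap.2 ⟨_, hz, rfl⟩), fun h g hg => ?_⟩
      (forall₂_congr fun x _ => ⟨fun h => h ⟨0, by omega⟩, fun h _ => h⟩)
    obtain ⟨A, hA, hg⟩ := List.mem_filterMap.1 hg
    cases A with
    | eq y z => simp [toRel] at hg
    | rel R z =>
      obtain rfl := Option.some.inj hg
      exact h R z hA
  refine ⟨Γ, fun c => (Nat.card_congr ?_).symm⟩
  -- One direction overwrites non-representatives by `b`; the other recovers their values from the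
  -- representatives.
  refine ⟨fun v => ⟨fun x => if rep x = x then v.1 x else b, ?_, (hΓ _).2 ⟨fun R z hz => ?_,
    fun x hx => if_neg hx⟩⟩, fun w => ⟨fun x => w.1 (rep x), ?_, fun A hA => ?_⟩, fun v => ?_,
    fun w => ?_⟩
  · exact (if_pos h0).trans v.2.1
  · simp only [hidem, if_true, hv v.1 v.2.2]
    exact v.2.2 _ hz
  · exact (congrArg w.1 h0).trans w.2.1
  · cases A with
    | eq y z => exact congrArg w.1 (heq y z hA)
    | rel R z => exact ((hΓ _).1 w.2.2).1 R z hA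
  · refine Subtype.ext (funext fun x => ?_)
    simp only [hidem, if_true]
    exact hv v.1 v.2.2 x
  · refine Subtype.ext (funext fun x => ?_)
    by_cases hx : rep x = x
    · simp only [hx, if_true]
    · simp only [hx, if_false]
      exact (((hΓ _).1 w.2.2).2 x hx).symm

/-- The number of ways to extend the value `c` of variable `0` to an assignment that satisfies a
list of relational atoms. -/
noncomputable def gadgetCount {m : ℕ} (Γ : List (H.RelAtom (Fin (m + 1)))) (c : H.carrier) : ℕ :=
  Nat.card {v : Fin (m + 1) → H.carrier // v 0 = c ∧ Sat Γ v}

/-- Instances have no equality constraints, so equalities are removed first; then the free variable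
becomes number 0 and the quantified ones follow. -/
theorem IsModSubalgebra.exists_gadget {p : ℕ} {A : Set H.carrier} (hA : H.IsModSubalgebra p A)
    (hconst : H.HasConstants) :
    ∃ (m : ℕ) (Γ : List (H.RelAtom (Fin (m + 1)))), ∀ c, c ∈ A ↔ ¬ p ∣ gadgetCount Γ c := by
  obtain ⟨m, Φ, hΦ⟩ := hA
  obtain ⟨Γ, hΓ⟩ := hconst.exists_sat_card_eq Φ (.inl 0)
  let e : Fin 1 ⊕ Fin m ≃ Fin (m + 1) := finSumFinEquiv.trans (finCongr (Nat.add_comm 1 m))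
  have he : e (.inl 0) = 0 := by
    ext
    simp [e]
  refine ⟨m, Γ.map fun g => ⟨g.1, fun s => e (g.2 s)⟩, fun c => ?_⟩
  rw [show c ∈ A ↔ ¬ p ∣ H.numExt Φ fun _ => c from hΦ fun _ => c]
  refine not_congr (iff_of_eq (congrArg (p ∣ ·) ?_))
  have h1 : H.numExt Φ (fun _ => c) =
      Nat.card {v : Fin 1 ⊕ Fin m → H.carrier // v (.inl 0) = c ∧ ∀ A ∈ Φ, A.Holds v} := by
    refine Nat.card_congr ⟨fun y => ⟨Sum.elim (fun _ => c) y.1, rfl, y.2⟩,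
      fun v => ⟨fun j => v.1 (.inr j), ?_⟩, fun y => rfl, fun v => Subtype.ext ?_⟩
    · have hv : Sum.elim (fun _ => c) (fun j => v.1 (.inr j)) = v.1 := by
        funext x
        rcases x with x | x
        · rw [Subsingleton.elim x 0]
          exact v.2.1.symm
        · rfl
      rw [hv]
      exact v.2.2
    · funext x
      rcases x with x | x
      · rw [Subsingleton.elim x 0]
        exact v.2.1.symm
      · rfl
  rw [h1, ← hΓ c]
  refine (Nat.card_congr ((e.symm.arrowCongr (Equiv.refl _)).subtypeEquiv fun v => ?_)).symm
  refine and_congr ?_ ?_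
  · simp [he]
  · simp only [Sat, List.forall_mem_map]
    rfl

/-- Gadgets that single out the two domains of `H.splitAt f a`. -/
theorem exists_gadgets (hconst : H.HasConstants) (hfix : ∀ x, f a x = x ↔ x = a)
    (hsub : H.IsModSubalgebra 2 {x | x ≠ a}) :
    ∃ (m : ℕ) (Γ : Fin 2 → List (H.RelAtom (Fin (m + 1)))),
      ∀ i c, InDom H f a i c ↔ ¬ 2 ∣ gadgetCount (Γ i) c := by
  obtain ⟨m, Γ, hΓ⟩ := hsub.exists_gadget hconst
  obtain ⟨C, hC, hCrel⟩ := hconst a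
  -- For sort 1, whose domain is {a}, all m + 1 variables are set to `a`: one extension at `a`, none
  -- elsewhere. Both gadgets have the same number of variables, which keeps the numbering of
  -- variables uniform.
  refine ⟨m, fun i => if i = 0 then Γ else (List.finRange (m + 1)).map fun k => ⟨C, fun _ => k⟩,
    fun i c => ?_⟩
  by_cases hi : i = 0
  · simp only [InDom, hi, if_true]
    exact hΓ c
  · simp only [InDom, hi, if_false, hfix]
    have hsat : ∀ v : Fin (m + 1) → H.carrier,
        Sat ((List.finRange (m + 1)).map fun k => (⟨C, fun _ => k⟩ : H.RelAtom (Fin (m + 1)))) v ↔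
          v = fun _ => a := by
      intro v
      simp only [Sat, List.forall_mem_map, List.mem_finRange, true_implies, hCrel, funext_iff]
      exact forall_congr' fun k => ⟨fun h => h ⟨0, by omega⟩, fun h _ => h⟩
    simp only [gadgetCount, hsat]
    by_cases hc : c = a
    · subst hc
      have : Nat.card {v : Fin (m + 1) → H.carrier // v 0 = c ∧ v = fun _ => c} = 1 := by
        rw [Nat.card_eq_one_iff_exists]
        exact ⟨⟨fun _ => c, rfl, rfl⟩, fun v => Subtype.ext v.2.2⟩
      simp [this]
    · have : IsEmpty {v : Fin (m + 1) → H.carrier // v 0 = c ∧ v = fun _ => a} :=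
        ⟨fun v => hc (by rw [← v.2.1, v.2.2])⟩
      simp [hc, Nat.card_of_isEmpty]

/-- The instance over `H` in which the domains of the variables are enforced by gadgets: variable
`v` becomes variable `0` of its own copy of the gadget for its sort. -/
def mergeInstance {m : ℕ} (Γ : Fin 2 → List (H.RelAtom (Fin (m + 1))))
    (J : (H.splitAt f a).Instance) : H.toMulti.Instance where
  n := (m + 1) * J.n
  τ _ := ()
  constraints :=
    (List.finRange J.n).flatMap (fun v => (Γ (J.τ v)).map fun g =>
      ⟨g.1, fun s => finProdFinEquiv (g.2 s, v), fun _ => rfl⟩) ++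
    J.constraints.map fun c => ⟨c.symb.1, fun s => finProdFinEquiv (0, c.scope s), fun _ => rfl⟩

theorem mergeInstance_isSolution_iff {m : ℕ} (Γ : Fin 2 → List (H.RelAtom (Fin (m + 1))))
    (J : (H.splitAt f a).Instance) (φ : Fin ((m + 1) * J.n) → H.carrier) :
    (mergeInstance Γ J).IsSolution φ ↔
      (∀ v, Sat (Γ (J.τ v)) fun k => φ (finProdFinEquiv (k, v))) ∧
        ∀ c ∈ J.constraints, (fun s => φ (finProdFinEquiv (0, c.scope s))) ∈ H.rel c.symb.1 := by
  constructor
  · intro h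
    refine ⟨fun v g hg => ?_, fun c hc => ?_⟩
    · exact h _ (List.mem_append_left _ (List.mem_flatMap.2
        ⟨v, List.mem_finRange v, List.mem_map_of_mem hg⟩))
    · exact h _ (List.mem_append_right _ (List.mem_map_of_mem hc))
  · rintro ⟨h₁, h₂⟩ c hc
    rcases List.mem_append.1 hc with hc | hc
    · obtain ⟨v, -, hc⟩ := List.mem_flatMap.1 hc
      obtain ⟨g, hg, rfl⟩ := List.mem_map.1 hc
      exact h₁ v g hg
    · obtain ⟨c', hc', rfl⟩ := List.mem_map.1 hc
      exact h₂ c' hc'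

/-- A solution of the merged instance is an assignment of the original variables together with
independent extensions in the gadgets. The count is a sum of products of gadget counts, and modulo 2
each product is the indicator that all values lie in their domains. -/
theorem numSolutions_mergeInstance {m : ℕ} (Γ : Fin 2 → List (H.RelAtom (Fin (m + 1))))
    (hΓ : ∀ i c, InDom H f a i c ↔ ¬ 2 ∣ gadgetCount (Γ i) c) (J : (H.splitAt f a).Instance) :
    (mergeInstance Γ J).numSolutions % 2 = J.numSolutions % 2 := by
  classical
  let S : Set (Fin J.n → H.carrier) :=
    {φ | ∀ c ∈ J.constraints, (fun s => φ (c.scope s)) ∈ H.rel c.symb.1}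
  -- The equation on the index is a separate variable so that it can be eliminated; rewriting by it
  -- directly would meet the dependent type of `p.2`.
  have hy : ∀ (p : (φ : S) × ((v : Fin J.n) →
      {y : Fin (m + 1) → H.carrier // y 0 = φ.1 v ∧ Sat (Γ (J.τ v)) y})) (k : Fin (m + 1))
      (v : Fin J.n) (x : Fin (m + 1) × Fin J.n), x = (k, v) →
      (p.2 x.2).1 x.1 = (p.2 v).1 k := by
    rintro p k v _ rfl
    rfl
  have hext : ∀ p q : (φ : S) × ((v : Fin J.n) →
      {y : Fin (m + 1) → H.carrier // y 0 = φ.1 v ∧ Sat (Γ (J.τ v)) y}),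
      (∀ v, (p.2 v).1 = (q.2 v).1) → p = q := by
    rintro ⟨⟨φ, hφ⟩, y⟩ ⟨⟨φ', hφ'⟩, y'⟩ h
    obtain rfl : φ = φ' := funext fun v =>
      (y v).2.1.symm.trans ((congrFun (h v) 0).trans (y' v).2.1)
    obtain rfl : y = y' := funext fun v => Subtype.ext (h v)
    rfl
  have h1 : (mergeInstance Γ J).numSolutions = Nat.card ((φ : S) × ((v : Fin J.n) →
      {y : Fin (m + 1) → H.carrier // y 0 = φ.1 v ∧ Sat (Γ (J.τ v)) y})) := by
    refine Nat.card_congr ⟨fun ψ => ⟨⟨fun v => ψ.1 (finProdFinEquiv (0, v)),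
      ((mergeInstance_isSolution_iff Γ J ψ.1).1 ψ.2).2⟩, fun v =>
        ⟨fun k => ψ.1 (finProdFinEquiv (k, v)), rfl,
          ((mergeInstance_isSolution_iff Γ J ψ.1).1 ψ.2).1 v⟩⟩,
      fun p => ⟨fun x => (p.2 (finProdFinEquiv.symm x).2).1 (finProdFinEquiv.symm x).1,
        (mergeInstance_isSolution_iff Γ J _).2 ⟨fun v => ?_, fun c hc => ?_⟩⟩, fun ψ => ?_,
      fun p => ?_⟩
    · simp only [hy p _ _ _ (finProdFinEquiv.symm_apply_apply _)]
      exact (p.2 v).2.2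
    · simp only [hy p _ _ _ (finProdFinEquiv.symm_apply_apply _), (p.2 _).2.1]
      exact p.1.2 c hc
    · refine Subtype.ext (funext fun x => ?_)
      exact congrArg ψ.1 (finProdFinEquiv.apply_symm_apply x)
    · exact hext _ _ fun v => funext fun k => hy p k v _ (finProdFinEquiv.symm_apply_apply _)
  rw [h1, numSolutions_splitAt, Nat.card_sigma]
  simp only [Nat.card_pi]
  have h2 : ∀ i c, ((gadgetCount (Γ i) c : ℕ) : ZMod 2) = if InDom H f a i c then 1 else 0 := by
    intro i c
    by_cases h : InDom H f a i c
    · rw [if_pos h]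
      rw [hΓ, Nat.two_dvd_ne_zero] at h
      exact ZMod.natCast_eq_one_iff_odd.2 (Nat.odd_iff.2 h)
    · rw [if_neg h]
      rw [hΓ, not_not] at h
      exact (ZMod.natCast_eq_zero_iff _ _).2 h
  rw [← Nat.ModEq, ← ZMod.natCast_eq_natCast_iff]
  push_cast
  have h3 : ∀ φ : S, (∏ v, ((Nat.card {y : Fin (m + 1) → H.carrier //
      y 0 = φ.1 v ∧ Sat (Γ (J.τ v)) y} : ℕ) : ZMod 2)) =
      if ∀ v, InDom H f a (J.τ v) (φ.1 v) then 1 else 0 := by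
    intro φ
    refine (Finset.prod_congr rfl fun v _ => h2 _ _).trans ?_
    rw [Finset.prod_boole]
    simp
  rw [Finset.sum_congr rfl fun φ _ => h3 φ, Finset.sum_boole, ← Fintype.card_subtype,
    ← Nat.card_eq_fintype_card]
  refine congrArg _ (Nat.card_congr ?_)
  exact Equiv.subtypeSubtypeEquivSubtypeInter (· ∈ S) fun φ => ∀ v, InDom H f a (J.τ v) (φ v)

end RelStructure

/-! ### The reduction from `H.splitAt f a` to `H`, and the spectra. -/

namespace RelStructure

open MultiStructure RAM

variable {H : RelStructure} {f : H.carrier → H.carrier → H.carrier} {a : H.carrier}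

/-- The letters of the constraints of a gadget, for the variable `5[0]`. -/
noncomputable def gadgetExprs {m : ℕ} (Γ : List (H.RelAtom (Fin (m + 1)))) : List Expr :=
  Γ.flatMap fun g => .const (Fintype.equivFin H.toMulti.Symb g.1) ::
    (List.finRange (H.arity g.1)).map fun s => .add (scal 5) (mulExpr (g.2 s) sizeExpr)

/-- The words of the constraints of a gadget, for the variable `v` of `n`. -/
noncomputable def gadgetWord {m : ℕ} (Γ : List (H.RelAtom (Fin (m + 1)))) (n v : ℕ) : List ℕ :=
  Γ.flatMap fun g => (Fintype.equivFin H.toMulti.Symb g.1 : ℕ) ::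
    List.ofFn fun s => v + n * g.2 s

theorem map_eval_gadgetExprs {m : ℕ} (Γ : List (H.RelAtom (Fin (m + 1)))) {s : Store} {n v : ℕ}
    (hn : sizeExpr.eval s = n) (hv : s 5 0 = v) :
    (gadgetExprs Γ).map (fun e => e.eval s) = gadgetWord Γ n v := by
  simp only [gadgetExprs, gadgetWord, List.map_flatMap, List.map_cons, List.map_map,
    Function.comp_def, Expr.eval.eq_1, Expr.eval.eq_3, eval_mulExpr, hn, List.ofFn_eq_map]
  simp only [Expr.eval, hv, mul_comm]

theorem eval_of_mem_gadgetExprs {m : ℕ} {Γ : List (H.RelAtom (Fin (m + 1)))} {e : Expr}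
    (he : e ∈ gadgetExprs Γ) {s s' : Store} (h0 : s' 0 = s 0) (h5 : s' 5 = s 5) :
    e.eval s' = e.eval s := by
  obtain ⟨g, -, he⟩ := List.mem_flatMap.1 he
  rcases List.mem_cons.1 he with rfl | he
  · rfl
  · obtain ⟨k, -, rfl⟩ := List.mem_map.1 he
    simp only [Expr.eval, eval_mulExpr, h0, h5]

theorem length_gadgetWord {m : ℕ} (Γ : List (H.RelAtom (Fin (m + 1)))) (n v : ℕ) :
    (gadgetWord Γ n v).length = (gadgetExprs Γ).length := by
  simp [gadgetExprs, gadgetWord]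

/-- The word of `mergeInstance Γ J`. -/
theorem encode_mergeInstance {m : ℕ} (Γ : Fin 2 → List (H.RelAtom (Fin (m + 1))))
    (J : (H.splitAt f a).Instance) :
    (mergeInstance Γ J).encode = ((m + 1) * J.n) ::
      ((List.finRange ((m + 1) * J.n)).flatMap
        (fun _ => [(Fintype.equivFin H.toMulti.Srt () : ℕ)]) ++
      ((List.finRange J.n).flatMap (fun v => gadgetWord (Γ (J.τ v)) J.n v) ++
      J.constraints.flatMap fun c => (Fintype.equivFin H.toMulti.Symb c.symb.1 : ℕ) ::
          List.ofFn fun k => (c.scope k : ℕ))) := by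
  have h : ∀ {n : ℕ} (g : Fin n → ℕ), List.ofFn g = (List.finRange n).flatMap fun v => [g v] := by
    intro n g
    rw [List.ofFn_eq_map, List.map_eq_flatMap]
  refine congrArg₂ List.cons rfl (congrArg₂ HAppend.hAppend (h _) ?_)
  refine List.flatMap_append.trans (congrArg₂ HAppend.hAppend ?_ ?_)
  · refine List.flatMap_assoc.trans (List.flatMap_congr fun v _ => ?_)
    refine (List.flatMap_map ..).trans (List.flatMap_congr fun g _ => ?_)
    refine congrArg₂ List.cons rfl (congrArg List.ofFn (funext fun s => ?_))
    -- The pair (k, v) has number v + n * k, which the program computes as `v` plus `k` copies of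
    -- `n`.
    exact finProdFinEquiv_apply_val _
  · refine (List.flatMap_map ..).trans (List.flatMap_congr fun c _ => ?_)
    refine congrArg₂ List.cons rfl (congrArg List.ofFn (funext fun s => ?_))
    -- The pair (0, v) has number `v`, so the scopes of the original constraints are copied
    -- verbatim.
    refine (finProdFinEquiv_apply_val _).trans ?_
    simp

/-- There is one gadget of bounded size for each variable, so the query is linear in the input. -/
theorem length_encode_mergeInstance_le {m G : ℕ} (Γ : Fin 2 → List (H.RelAtom (Fin (m + 1))))
    (hG : ∀ i, (gadgetExprs (Γ i)).length ≤ G) (J : (H.splitAt f a).Instance) :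
    (mergeInstance Γ J).encode.length ≤ (m + 1) * J.n + J.n * G + J.encode.length := by
  have h1 : ((List.finRange J.n).flatMap fun v => gadgetWord (Γ (J.τ v)) J.n v).length ≤
      J.n * G := by
    rw [List.length_flatMap]
    refine (List.sum_le_card_nsmul _ G ?_).trans (by simp)
    intro x hx
    obtain ⟨v, -, rfl⟩ := List.mem_map.1 hx
    rw [length_gadgetWord]
    exact hG _
  have h2 : (J.constraints.flatMap fun c => (Fintype.equivFin H.toMulti.Symb c.symb.1 : ℕ) ::
      List.ofFn fun k => (c.scope k : ℕ)).length = (J.constraints.flatMap Constraint.encode).length := by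
    simp only [List.length_flatMap, Constraint.encode, List.length_cons]
  have h3 : ((List.finRange ((m + 1) * J.n)).flatMap
      (fun _ => [(Fintype.equivFin H.toMulti.Srt () : ℕ)])).length = (m + 1) * J.n := by
    simp [List.length_flatMap]
  rw [encode_mergeInstance, J.length_encode, Instance.pos, List.length_cons, List.length_append,
    List.length_append, h2, h3]
  omega

/-- The table of symbols for the translation of constraints of `H.splitAt f a`. -/
noncomputable def mergeTable (H : RelStructure) (f : H.carrier → H.carrier → H.carrier)
    (a : H.carrier) : List (Expr × ℕ × ℕ) :=
  Finset.univ.toList.map fun R : (H.splitAt f a).Symb =>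
    (neq symbExpr (.const (Fintype.equivFin (H.splitAt f a).Symb R)),
      Fintype.equivFin H.toMulti.Symb R.1, H.arity R.1)

/-- The reduction of the counting problem over `H.splitAt f a` to that over `H`. -/
noncomputable def mergeProg (f : H.carrier → H.carrier → H.carrier)
    (a : H.carrier) {m : ℕ} (Γ : Fin 2 → List (H.RelAtom (Fin (m + 1)))) : Prog :=
  .seq (push (mulExpr (m + 1) sizeExpr))
    (.seq (forLoop 5 (mulExpr (m + 1) sizeExpr)
        (push (.const (Fintype.equivFin H.toMulti.Srt ()))))
      (.seq (forLoop 5 sizeExpr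
          -- Letter 1 + v of the input is the sort of variable `v`; a nonzero difference from the
          -- code of sort 0 means sort 1.
          (.ite (neq (.get 0 (.add (.const 1) (scal 5)))
              (.const (Fintype.equivFin (H.splitAt f a).Srt (0 : Fin 2))))
            (pushAll (gadgetExprs (Γ 1))) (pushAll (gadgetExprs (Γ 0)))))
        (.seq (translateLoop (mergeTable H f a)) submit)))

theorem splitAt_polyTimeReducible {m : ℕ} {Γ : Fin 2 → List (H.RelAtom (Fin (m + 1)))}
    (hΓ : ∀ i c, InDom H f a i c ↔ ¬ 2 ∣ gadgetCount (Γ i) c) :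
    PolyTimeReducible ((H.splitAt f a).modCSP 2) (H.toMulti.modCSP 2) := by
  obtain ⟨G, hG⟩ : ∃ G, ∀ i, (gadgetExprs (Γ i)).length ≤ G :=
    ⟨∑ i, (gadgetExprs (Γ i)).length, fun i => Finset.single_le_sum
      (f := fun i => (gadgetExprs (Γ i)).length) (fun _ _ => Nat.zero_le _) (Finset.mem_univ i)⟩
  obtain ⟨r, hr⟩ : ∃ r, ∀ R, H.arity R ≤ r :=
    ⟨∑ R, H.arity R, fun R => Finset.single_le_sum (fun _ _ => Nat.zero_le _) (Finset.mem_univ R)⟩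
  obtain ⟨T, hT⟩ : ∃ T : Polynomial ℕ, ∀ n L, n ≤ L →
      2 + ((m + 1) * n * (2 + 2) + 2 + (n * (G * 2 + 1 + 1 + 2) + 2 +
        (L * ((r + 1) * 2 + 1 + 1 + (mergeTable H f a).length + 1) + 2 +
          ((m + 1) * n + n * G + L + 1)))) ≤ T.eval L := by
    refine ⟨2 + ((.C m + 1) * .X * (2 + 2) + 2 + (.X * (.C G * 2 + 1 + 1 + 2) + 2 +
        (.X * ((.C r + 1) * 2 + 1 + 1 + .C (mergeTable H f a).length + 1) + 2 +
          ((.C m + 1) * .X + .X * .C G + .X + 1)))), fun n L h => ?_⟩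
    simp only [Polynomial.eval_add, Polynomial.eval_mul, Polynomial.eval_X, Polynomial.eval_C,
      Polynomial.eval_ofNat, Polynomial.eval_one]
    gcongr
  refine ⟨mergeProg f a Γ, T, fun O hO J => ?_⟩
  change (H.splitAt f a).Instance at J
  change ∃ s t, Exec O _ (initStore J.encode) s t ∧ t ≤ T.eval J.encode.length ∧
    s 0 0 = J.numSolutions % 2
  suffices h : Run O (mergeProg f a Γ) (initStore J.encode) (T.eval J.encode.length)
      fun s => s 0 0 = J.numSolutions % 2 from h
  have h0 := inputAt_initStore J.encode
  have hout : Out (initStore J.encode) [] := by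
    rw [Out, initStore_of_ne _ (by decide) (by decide)]
    rfl
  generalize initStore J.encode = s₀ at h0 hout ⊢
  have hsize : ∀ {s : Store}, InputAt J.encode s → sizeExpr.eval s = J.n :=
    fun h => congrFun h.1 0
  have hmul : ∀ {s : Store}, InputAt J.encode s →
      (mulExpr (m + 1) sizeExpr).eval s = (m + 1) * J.n := fun h => by
    rw [eval_mulExpr, hsize h]
  refine Run.mono (Q := fun s => s 0 0 = J.numSolutions % 2) ?_ (hT J.n _ J.n_le_length)
    fun _ => id
  refine Run.seq (Run.push hout fun s₁ h₁ hout₁ => ?_)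
  have hin₁ := h0.agreeOff h₁.agreeOff
  rw [hmul h0, List.nil_append] at hout₁
  refine Run.seq (Run.outLoop (N := (m + 1) * J.n) (Tb := 2) hout₁
    (fun _ => [(Fintype.equivFin H.toMulti.Srt () : ℕ)])
    (fun s' hs' => hmul (hin₁.agreeOff hs'))
    (fun i s' l' hs' hi hl' => by
      refine Run.push hl' fun s'' h₆ h₇ => ⟨h₆.agreeOff, ?_⟩
      exact h₇)
    fun s₂ h₂ hout₂ => ?_)
  have hin₂ := hin₁.agreeOff h₂
  refine Run.seq (Run.outLoop (N := J.n) (Tb := G * 2 + 1 + 1) hout₂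
    (fun v => gadgetWord (Γ (J.τ v)) J.n v) (fun s' hs' => hsize (hin₂.agreeOff hs'))
    (fun v s' l' hs' hi hl' => ?_) fun s₃ h₃ hout₃ => ?_)
  · have hin' := hin₂.agreeOff hs'
    have he : (Expr.get 0 (.add (.const 1) (scal 5))).eval s' =
        (Fintype.equivFin (H.splitAt f a).Srt (J.τ v) : ℕ) := by
      simp only [Expr.eval]
      rw [hi, hin'.1]
      exact J.getD_encode_sort v
    have hpush : ∀ i : Fin 2, J.τ v = i → Run O (pushAll (gadgetExprs (Γ i))) s' (G * 2 + 1)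
        fun s'' => AgreeOff [2, 3] s' s'' ∧ Out s'' (l' ++ gadgetWord (Γ (J.τ v)) J.n v) := by
      rintro i rfl
      refine (Run.pushAll hl' (fun e he s'' hs'' => eval_of_mem_gadgetExprs he
        (hs'' 0 (by decide) (by decide)) (hs'' 5 (by decide) (by decide)))
        fun s'' h₅ h₆ => ⟨h₅.agreeOff, ?_⟩).mono (by have := hG (J.τ v); omega) fun _ => id
      rwa [map_eval_gadgetExprs _ (hsize hin') hi] at h₆
    refine Run.ite (fun h => hpush 1 ?_) fun h => hpush 0 ?_
    · rw [Ne, eval_neq, he] at h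
      have : ∀ i : Fin 2, i ≠ 0 → i = 1 := by decide
      refine this _ fun h0 => h ?_
      rw [h0]
      rfl
    · rw [eval_neq, he] at h
      exact (Fintype.equivFin (H.splitAt f a).Srt).injective (Fin.ext h)
  have hin₃ := hin₂.agreeOff h₃
  refine Run.seq (Run.translateLoop (K := H.splitAt f a) (fun R => hr R.1)
    (fun c => Fintype.equivFin H.toMulti.Symb c.symb.1) hin₃ hout₃
    (fun d c rest h s' hs' hp => ?_) (fun d c rest h s' hs' hp b hb h0 => ?_) fun s₄ hout₄ => ?_)
  · refine ⟨_, List.mem_map_of_mem (Finset.mem_toList.2 (Finset.mem_univ c.symb)), ?_⟩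
    rw [eval_neq, eval_symbExpr h (hin₃.agreeOff hs') hp]
    rfl
  · obtain ⟨R, -, rfl⟩ := List.mem_map.1 hb
    rw [eval_neq, eval_symbExpr h (hin₃.agreeOff hs') hp] at h0
    obtain rfl : c.symb = R := (Fintype.equivFin (H.splitAt f a).Symb).injective (Fin.ext h0)
    exact ⟨rfl, rfl⟩
  rw [List.singleton_append, List.cons_append, List.cons_append, List.append_assoc,
    ← encode_mergeInstance] at hout₄
  refine (Run.submit hout₄ fun s' hs' => ?_).mono
    (Nat.succ_le_succ (length_encode_mergeInstance_le Γ hG J)) fun _ => id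
  rw [hs', ← numSolutions_mergeInstance Γ hΓ J]
  exact hO (mergeInstance Γ J)

/-- Each new domain misses an element of `H`, so it has fewer than three elements; the entry at 3
drops from 1 to 0 and all later entries vanish. -/
theorem spectrumLT_splitAt (hcard : Fintype.card H.carrier = 3) (hfix : ∀ x, f a x = x ↔ x = a) :
    SpectrumLT (H.splitAt f a).spectrum H.toMulti.spectrum := by
  have hlt : ∀ i, Nat.card ((H.splitAt f a).Dom i) < 3 := by
    intro i
    change Fin 2 at i
    have h3 : Nat.card H.carrier = 3 := by rw [Nat.card_eq_fintype_card, hcard]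
    obtain ⟨x, hx⟩ : ∃ x, ¬ InDom H f a i x := by
      by_cases hi : i = 0
      · exact ⟨a, by simp [InDom, hi]⟩
      · obtain ⟨x, hx⟩ : ∃ x, x ≠ a :=
          Fintype.exists_ne_of_one_lt_card (by omega) a
        exact ⟨x, by simp [InDom, hi, hfix, hx]⟩
    rw [← h3]
    exact Finite.card_subtype_lt (p := InDom H f a i) hx
  have hcardM : ∀ j, H.toMulti.spectrum j = if j = 3 then 1 else 0 := by
    intro j
    have h3 : ∀ i, Nat.card (H.toMulti.Dom i) = 3 := fun i => by
      change Nat.card H.carrier = 3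
      rw [Nat.card_eq_fintype_card, hcard]
    simp only [MultiStructure.spectrum, h3]
    by_cases hj : j = 3
    · subst hj
      simp only [if_true]
      exact (Nat.card_congr (Equiv.subtypeUnivEquiv fun _ => trivial)).trans
        (Nat.card_eq_fintype_card.trans Fintype.card_unit)
    · simp [hj, Ne.symm hj]
  have hzero : ∀ j, 3 ≤ j → (H.splitAt f a).spectrum j = 0 := by
    intro j hj
    have : IsEmpty {i // Nat.card ((H.splitAt f a).Dom i) = j} :=
      ⟨fun i => by have := hlt i.1; have := i.2; omega⟩
    exact Nat.card_of_isEmpty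
  refine ⟨3, by omega, ?_, fun i hi => ?_⟩
  · rw [hzero 3 le_rfl, hcardM]
    decide
  · rw [hzero i hi.le, hcardM, if_neg (by omega)]

end RelStructure

theorem corollary3p3 (H : RelStructure) (hcard : Fintype.card H.carrier = 3)
    (hconst : H.HasConstants)
    (f : H.carrier → H.carrier → H.carrier) (hf : H.IsAutomorphicPolynomial 2 f)
    (a : H.carrier) (ha : IsPermOfOrder 2 (f a))
    (hsub : H.IsModSubalgebra 2 {a}) (hsub' : H.IsModSubalgebra 2 {x | x ≠ a}) :
    SpectrumLT (H.splitAt f a).spectrum H.toMulti.spectrum ∧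
      PolyTimeInterreducible (H.toMulti.modCSP 2) ((H.splitAt f a).modCSP 2) := by
  obtain ⟨hfix, hid⟩ := hf.eq_ite hcard hconst ha hsub'
  obtain ⟨m, Γ, hΓ⟩ := RelStructure.exists_gadgets hconst hfix hsub'
  exact ⟨RelStructure.spectrumLT_splitAt hcard hfix,
    RelStructure.polyTimeReducible_splitAt hfix (hf.involutive a) hid hf.1,
    RelStructure.splitAt_polyTimeReducible hΓ⟩
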